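/- Let $(p_k)_{k\ge 0}$ be a possibly defective probability distribution ($p_k\ge 0$, $\sum_k p_k\le 1$) with $p_1\neq 1$, and let $f(s)=\sum_{k\ge0}p_ks^k$. Let $\{Z_t\}_{t\ge 0}$ be the continuous-time Markov branching process with $Z_0=1$ in which particles have independent exponential life lengths with mean one, and each particle at its death is replaced by $k$ particles with probability $p_k$, or, with probability $1-f(1)$, sends the whole process to an absorbing graveyard state $\Delta$. That is, $\{Z_t\}$ is the right-continuous Markov process on $\{0,1,2,\dots\}\cup\{\Delta\}$ with transition rates $i\,p_k$ from $i$ to $i-1+k$ ($k\ne1$) and $i(1-f(1))$ from $i$ to $\Delta$. Let $T_0$ and $T_1$ be the absorption times at $0$ and at $\Delta$, and $T=\min(T_0,T_1)$. Assume that $f$ is $(q,r)$-extendable with $r>1$, that is, $0\le q\le 1<r<\infty$, $f(q)=q$ and $f(r)=r$, and that $f'(r)=\sum_k kp_kr^{k-1}<\infty$. Put $\alpha=1-f'(q)$, $\beta=f'(r)-1$, $\gamma=\alpha/\beta$. For $n\ge 1$ let $$f^{(n)}(s_1,\dots,s_n)=\sum_{i_1,\dots,i_n\ge 0}p_{i_1+\dots+i_n+n-1}\,s_1^{i_1}\cdots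 s_n^{i_n},$$ $$\psi_{q,r}(x)=\frac{f^{(4)}(q,q,r,x)-\gamma f^{(4)}(q,r,r,x)}{f^{(3)}(q,r,x)},\qquad x\in[0,r),$$ $$K(s)=(s-q)(r-q)^{\gamma}(r-s)^{-\gamma}\exp\Big\{\int_s^q\psi_{q,r}(x)\,dx\Big\},\qquad s\in[0,r).$$ Then, as $t\to\infty$, $$\mathrm P(T>t)=(K(1)-K(0))e^{-\alpha t}-\frac{f''(q)}{2\alpha}\big(K^2(1)-K^2(0)\big)e^{-2\alpha t}+o(e^{-2\alpha t}).$$ Moreover, there are numbers $\pi_k$ such that $$\mathrm P(Z_t=k\mid T>t)\to\pi_k\quad (k\ge 1),\qquad \sum_{k\ge 1}\pi_ks^k=\frac{K(s)-K(0)}{K(1)-K(0)},\quad s\in[0,r);$$ in particular, $\sum_{k\ge1}\pi_k=1$. Finally, suppose that $f$ is modified linear-fractional, that is, $$f(s)=p_0+p_1s+(1-p_0-p_1-p_\Delta)\,\frac{(1-p)s^2}{1-ps}\qquad\text{for all } s\ge0\text{ with } ps<1,$$ for some $p_0,p_1,p_\Delta,p\in[0,1)$ with $p_0+p_1+p_\Delta<1$.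 Then $K(s)=(s-q)(r-q)^{\gamma}(r-s)^{-\gamma}$ for $s\in[0,r)$, and $\pi_k\sim c\,k^{\gamma-1}r^{-k}$ as $k\to\infty$ for some positive constant $c$. -/

import Mathlib

open Filter Topology MeasureTheory
open scoped NNReal ENNReal

namespace ExtBranching

/-! ### Reproduction laws and generating functions -/

/-- A possibly defective offspring law: `p k` is the probability of `k` offspring, and the missing
mass `1 - ∑ p k` is the probability that a splitting particle terminates the whole process. -/
structure IsOffspringLaw (p : ℕ → ℝ) : Prop where
  nonneg : ∀ k, 0 ≤ p k
  summable : Summable p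
  tsum_le_one : ∑' k, p k ≤ 1

/-- `f` is `(q,r)`-extendable: `0 ≤ q ≤ 1 ≤ r < ∞`, `q < r`, `f q = q` and `f r = r`, where
`f s = ∑ p k * s ^ k`. -/
structure IsExtendable (p : ℕ → ℝ) (q r : ℝ) : Prop where
  nonneg : 0 ≤ q
  le_one : q ≤ 1
  one_le : 1 ≤ r
  lt : q < r
  fixed_q : HasSum (fun k => p k * q ^ k) q
  fixed_r : HasSum (fun k => p k * r ^ k) r

/-- The first derivative `f' s` of the generating function, as a power series. -/
noncomputable def genDeriv (p : ℕ → ℝ) (s : ℝ) : ℝ :=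
  ∑' k : ℕ, (k : ℝ) * p k * s ^ (k - 1)

/-- The second derivative `f'' s` of the generating function, as a power series. -/
noncomputable def genDeriv₂ (p : ℕ → ℝ) (s : ℝ) : ℝ :=
  ∑' k : ℕ, (k : ℝ) * ((k : ℝ) - 1) * p k * s ^ (k - 2)

/-- The `n`-th order tail generating function of the power series with coefficients `v`, `n ≥ 1`. -/
noncomputable def tailGF (v : ℕ → ℝ) (n : ℕ) (s : Fin n → ℝ) : ℝ :=
  ∑' i : Fin n → ℕ, v ((∑ j, i j) + n - 1) * ∏ j, s j ^ i j

/-- `α = 1 - f' q`. -/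
noncomputable def alphaOf (p : ℕ → ℝ) (q : ℝ) : ℝ := 1 - genDeriv p q

/-- `β = f' r - 1`. -/
noncomputable def betaOf (p : ℕ → ℝ) (r : ℝ) : ℝ := genDeriv p r - 1

/-- `γ = α / β`. -/
noncomputable def gammaOf (p : ℕ → ℝ) (q r : ℝ) : ℝ := alphaOf p q / betaOf p r

/-- The function `ψ_{q,r}`. -/
noncomputable def psi (p : ℕ → ℝ) (q r x : ℝ) : ℝ :=
  (tailGF p 4 ![q, q, r, x] - gammaOf p q r * tailGF p 4 ![q, r, r, x]) / tailGF p 3 ![q, r, x]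

/-- The function `K`, to be used for `s ∈ [0, r)`. -/
noncomputable def K (p : ℕ → ℝ) (q r s : ℝ) : ℝ :=
  (s - q) * (r - q) ^ gammaOf p q r * (r - s) ^ (-gammaOf p q r) *
    Real.exp (∫ x in s..q, psi p q r x)

/-- Modified linear-fractional laws with parameters `(p₀, p₁, p_Δ, a)`. -/
def IsModifiedLinearFractional (p : ℕ → ℝ) : Prop :=
  ∃ p₀ p₁ pΔ a : ℝ, 0 ≤ p₀ ∧ p₀ < 1 ∧ 0 ≤ p₁ ∧ p₁ < 1 ∧ 0 ≤ pΔ ∧ pΔ < 1 ∧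
    p₀ + p₁ + pΔ < 1 ∧ 0 ≤ a ∧ a < 1 ∧
    ∀ s : ℝ, 0 ≤ s → a * s < 1 →
      HasSum (fun k => p k * s ^ k)
        (p₀ + p₁ * s + (1 - p₀ - p₁ - pΔ) * s ^ 2 * (1 - a) * (1 - a * s)⁻¹)

/-! ### The branching process

The state space is `Option ℕ`: `some i` means that `i` particles are alive, and `none` is the
graveyard state. -/

/-- Transition rates of the branching process. Each of the `i` particles alive splits at rate one;
it is then replaced by `k` particles with probability `p k`, and sends the whole process to the
graveyard with probability `1 - ∑ p k`. -/
noncomputable def rate (p : ℕ → ℝ) : Option ℕ → Option ℕ → ℝ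
  | none, _ => 0
  | some i, none => (i : ℝ) * (1 - ∑' k, p k)
  | some i, some j =>
      (i : ℝ) * ((if i ≤ j + 1 then p (j + 1 - i) else 0) - (if i = j then 1 else 0))

/-- `P t x y` is a (stochastic) Markov transition function on the state space, whose
infinitesimal rates are those of the branching process with offspring law `p`. -/
structure IsTransitionFunction (p : ℕ → ℝ) (P : ℝ≥0 → Option ℕ → Option ℕ → ℝ) : Prop where
  nonneg : ∀ t x y, 0 ≤ P t x y
  hasSum_one : ∀ t x, HasSum (fun y => P t x y) 1
  zero : ∀ x y, P 0 x y = if x = y then 1 else 0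
  chapman_kolmogorov : ∀ s t x z, HasSum (fun y => P s x y * P t y z) (P (s + t) x z)
  rates : ∀ x y, Tendsto (fun h : ℝ≥0 => (P h x y - P 0 x y) / (h : ℝ)) (𝓝[>] 0) (𝓝 (rate p x y))

/-- `Z` is a continuous-time Markov branching process with offspring law `p` and mean life length
one, started from a single particle: a right-continuous time-homogeneous Markov process (with
respect to the discrete topology on the countable state space) with the above transition rates. -/
structure IsBranchingProcess {Ω : Type*} [MeasurableSpace Ω] (μ : Measure Ω) (p : ℕ → ℝ)
    (Z : ℝ≥0 → Ω → Option ℕ) : Prop where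
  measurable : ∀ t x, MeasurableSet {ω | Z t ω = x}
  right_continuous : ∀ᵐ ω ∂μ, ∀ t : ℝ≥0, ∀ᶠ s in 𝓝[>] t, Z s ω = Z t ω
  initial : ∀ᵐ ω ∂μ, Z 0 ω = some 1
  markov : ∃ P : ℝ≥0 → Option ℕ → Option ℕ → ℝ, IsTransitionFunction p P ∧
    ∀ (n : ℕ) (t : ℕ → ℝ≥0) (x : ℕ → Option ℕ), Monotone t → t 0 = 0 → x 0 = some 1 →
      μ.real {ω | ∀ i ≤ n, Z (t i) ω = x i} =
        ∏ i ∈ Finset.range n, P (t (i + 1) - t i) (x i) (x (i + 1))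

/-- The first time at which the process is in state `x` (`∞` if it never is). -/
noncomputable def hittingTime {Ω : Type*} (Z : ℝ≥0 → Ω → Option ℕ) (x : Option ℕ) (ω : Ω) : ℝ≥0∞ :=
  sInf ((fun s : ℝ≥0 => (s : ℝ≥0∞)) '' {s | Z s ω = x})

/-- The overall absorption time `T = min(T₀, T₁)`, with `T₀` the absorption time at `0` and `T₁`
the absorption time at the graveyard state. -/
noncomputable def absorptionTime {Ω : Type*} (Z : ℝ≥0 → Ω → Option ℕ) (ω : Ω) : ℝ≥0∞ :=
  min (hittingTime Z (some 0) ω) (hittingTime Z none ω)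

end ExtBranching

/-! Write `φ_t(s)` for the solution of `y' = f(y) - y` with `y(0) = s`. Dividing out both fixed
points gives `f(x) - x = (x - q)(x - r) w(x)`, where `w(x) = f^{(3)}(q,r,x)` is a power series with
nonnegative coefficients, positive on `[0, r]`, and `w(q) = α/(r - q)`, `w(r) = β/(r - q)`. Hence `γ
= w(q)/w(r)`, and partial fractions turn `α/(x - f(x))` into `1/(x - q) + γ/(r - x) - ψ(x)`, which
is the logarithmic derivative of `K`. So `K(φ_t(s)) = e^{-αt} K(s)`: in the coordinate `K` the
equation is linear, and `φ` is obtained by inverting the increasing function `K`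
(`one_add_sub_mul_psi`, `hasDerivAt_kF`, `hasDerivWithinAt_flow`).

The process enters through `E s^{Z_t} = φ_t(s)` for all `s` in `[0, r)`, including `s > 1`
(`hasSum_flow`). A transition function is known only through its rates at time zero, and neither the
branching property nor a moment bound is assumed. The identity is therefore proved for every initial
state `i`, with `φ_t(s)^i` on the right, by comparing both sides as solutions of the backward
equation. The comparison principle `le_of_touching` is used with two barriers: a linear one for the
upper bound on truncated powers, and a larger power of the flow for the lower bound.

The rest is analysis of `φ`. Absorption makes `P(T > t) = φ_t(1) - φ_t(0)`. Since `K(x) = (x - q)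
E(x)` with `E(q) = 1` and `E'(q) = f''(q)/(2α)`, inverting to second order at `q` gives the
expansion (`flow_sub_isLittleO`). The conditional generating functions converge to `(K(s) -
K(0))/(K(1) - K(0))`, and a continuity theorem for power series (`exists_tendsto_coeff`) passes this
to the coefficients. For modified linear-fractional laws all divided differences are geometric and
the numerator of `ψ` cancels; the binomial series of `(r - s)^{-γ}` and Euler's limit for the Gamma
function then give the tail of `π`. -/

namespace ExtBranching

/-! ### Divided differences on coefficient sequences -/

/-- The coefficients of the divided difference `(C x - C a) / (x - a)` of `C x = ∑ c k * x ^ k`. -/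
noncomputable def tailSeq (a : ℝ) (c : ℕ → ℝ) (k : ℕ) : ℝ := ∑' i, c (k + 1 + i) * a ^ i

section tailSeq

variable {a x : ℝ} {c : ℕ → ℝ}

lemma tailSeq_nonneg (hc : ∀ k, 0 ≤ c k) (ha : 0 ≤ a) (k : ℕ) : 0 ≤ tailSeq a c k :=
  tsum_nonneg fun i => mul_nonneg (hc _) (pow_nonneg ha i)

lemma summable_shift (h : Summable fun n => c n * a ^ n) (k : ℕ) :
    Summable fun i => c (k + i) * a ^ i := by
  rcases eq_or_ne a 0 with rfl | ha
  · exact summable_of_ne_finset_zero (s := {0}) fun i hi => by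
      rw [Finset.mem_singleton] at hi
      simp [hi]
  · have h1 := ((summable_nat_add_iff k).2 h).mul_right ((a ^ k)⁻¹)
    refine h1.congr fun i => ?_
    have : a ^ k ≠ 0 := pow_ne_zero _ ha
    rw [pow_add, add_comm i k]
    field_simp

/-- Horner's recursion: it recovers `c` from its divided difference. -/
lemma tailSeq_eq (h : Summable fun n => c n * a ^ n) (k : ℕ) :
    tailSeq a c k = c (k + 1) + a * tailSeq a c (k + 1) := by
  unfold tailSeq
  rw [(summable_shift h (k + 1)).tsum_eq_zero_add, ← tsum_mul_left]
  simp only [add_zero, pow_zero, mul_one]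
  congr 1
  refine tsum_congr fun i => ?_
  rw [show k + 1 + (i + 1) = k + 1 + 1 + i by ring, pow_succ]
  ring

/-- Tonelli for the nonnegative double series `c (i + j + 1) * x ^ i * a ^ j`, summed along rows and
along diagonals. The diagonal sums are `(x ^ (n + 1) - a ^ (n + 1)) / (x - a)` when `x ≠ a` and `(n
+ 1) * a ^ n` when `x = a`, so both cases follow from one statement. -/
lemma hasSum_tailSeq (hc : ∀ k, 0 ≤ c k) (ha : 0 ≤ a) (hx : 0 ≤ x)
    (h : Summable fun n => c (n + 1) * ∑ ij ∈ Finset.HasAntidiagonal.antidiagonal n, x ^ ij.1 * a ^ ij.2) :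
    HasSum (fun k => tailSeq a c k * x ^ k)
      (∑' n, c (n + 1) * ∑ ij ∈ Finset.HasAntidiagonal.antidiagonal n, x ^ ij.1 * a ^ ij.2) := by
  set F : ℕ × ℕ → ℝ := fun z => c (z.1 + 1 + z.2) * a ^ z.2 * x ^ z.1 with hF
  have hF0 : ∀ z, 0 ≤ F z := fun z =>
    mul_nonneg (mul_nonneg (hc _) (pow_nonneg ha _)) (pow_nonneg hx _)
  have hfib : ∀ n, HasSum (fun ij : Finset.HasAntidiagonal.antidiagonal n => F ij)
      (c (n + 1) * ∑ ij ∈ Finset.HasAntidiagonal.antidiagonal n, x ^ ij.1 * a ^ ij.2) := fun n => by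
    have h1 := hasSum_fintype (fun ij : Finset.HasAntidiagonal.antidiagonal n => F ij)
    rw [Finset.sum_coe_sort (Finset.HasAntidiagonal.antidiagonal n) F] at h1
    convert h1 using 1
    rw [Finset.mul_sum]
    refine Finset.sum_congr rfl fun ij hij => ?_
    rw [Finset.HasAntidiagonal.mem_antidiagonal] at hij
    simp only [hF]
    rw [show ij.1 + 1 + ij.2 = n + 1 by omega]
    ring
  have hsig : Summable fun z : Σ n : ℕ, Finset.HasAntidiagonal.antidiagonal n => F z.2 := by
    refine (summable_sigma_of_nonneg fun z => hF0 _).2 ⟨fun n => (hfib n).summable, ?_⟩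
    exact h.congr fun n => (hfib n).tsum_eq.symm
  have hsum : Summable F :=
    (Finset.HasAntidiagonal.sigmaAntidiagonalEquivProd (A := ℕ)).summable_iff.1 hsig
  have htot : HasSum F (∑' n, c (n + 1) * ∑ ij ∈ Finset.HasAntidiagonal.antidiagonal n, x ^ ij.1 * a ^ ij.2) := by
    refine (Finset.HasAntidiagonal.sigmaAntidiagonalEquivProd (A := ℕ)).hasSum_iff.1 ?_
    have := hsig.hasSum
    rwa [hsig.tsum_sigma' fun n => (hfib n).summable,
      tsum_congr fun n => (hfib n).tsum_eq] at this
  refine htot.prod_fiberwise fun k => ?_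
  have h2 : Summable fun i => F (k, i) := hsum.prod_factor k
  have h3 := h2.hasSum
  simp only [hF] at h3
  rwa [tsum_mul_right] at h3

lemma hasSum_tailSeq_of_ne (hc : ∀ k, 0 ≤ c k) (ha : 0 ≤ a) (hx : 0 ≤ x) (hax : x ≠ a)
    {Cx Ca : ℝ} (hCx : HasSum (fun n => c n * x ^ n) Cx) (hCa : HasSum (fun n => c n * a ^ n) Ca) :
    HasSum (fun k => tailSeq a c k * x ^ k) ((Cx - Ca) / (x - a)) := by
  have hd : x - a ≠ 0 := sub_ne_zero.2 hax
  have h1 : HasSum (fun n => c (n + 1) * ∑ ij ∈ Finset.HasAntidiagonal.antidiagonal n, x ^ ij.1 * a ^ ij.2)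
      ((Cx - Ca) / (x - a)) := by
    have h2 := (hasSum_nat_add_iff' 1).2 ((hCx.sub hCa).div_const (x - a))
    simp only [Finset.range_one, Finset.sum_singleton, pow_zero, sub_self, zero_div, sub_zero] at h2
    refine h2.congr_fun fun n => ?_
    rw [Finset.Nat.sum_antidiagonal_eq_sum_range_succ (fun i j => x ^ i * a ^ j), eq_div_iff hd,
      mul_assoc]
    have := (Commute.all x a).geom_sum₂_mul (n + 1)
    simp only [Nat.add_sub_cancel] at this
    rw [this]
    ring
  have h3 := hasSum_tailSeq hc ha hx h1.summable
  rwa [h1.tsum_eq] at h3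

lemma hasSum_tailSeq_self (hc : ∀ k, 0 ≤ c k) (ha : 0 ≤ a) {D : ℝ}
    (hD : HasSum (fun n : ℕ => ((n : ℝ) + 1) * c (n + 1) * a ^ n) D) :
    HasSum (fun k => tailSeq a c k * a ^ k) D := by
  have h1 : HasSum (fun n => c (n + 1) * ∑ ij ∈ Finset.HasAntidiagonal.antidiagonal n, a ^ ij.1 * a ^ ij.2) D := by
    refine hD.congr_fun fun n => ?_
    rw [Finset.sum_congr rfl (g := fun _ => a ^ n)]
    · simp; ring
    · intro ij hij
      rw [Finset.HasAntidiagonal.mem_antidiagonal] at hij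
      rw [← pow_add, hij]
  have h3 := hasSum_tailSeq hc ha ha h1.summable
  rwa [h1.tsum_eq] at h3

/-- Divided differences are symmetric in their nodes: both sides sum `c (k + 2 + i + j) * a ^ i * b
^ j`, in the two orders. -/
lemma tailSeq_comm {b : ℝ} (hc : ∀ k, 0 ≤ c k) (ha : 0 ≤ a) (hb : 0 ≤ b)
    (h1 : Summable fun n => c n * b ^ n) (h2 : Summable fun n => tailSeq b c n * a ^ n) :
    tailSeq a (tailSeq b c) = tailSeq b (tailSeq a c) := by
  funext k
  set F : ℕ × ℕ → ℝ := fun z => c (k + 1 + z.1 + 1 + z.2) * b ^ z.2 * a ^ z.1 with hF'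
  have hF0 : ∀ z, 0 ≤ F z := fun z =>
    mul_nonneg (mul_nonneg (hc _) (pow_nonneg hb _)) (pow_nonneg ha _)
  have hfib : ∀ i, HasSum (fun j => F (i, j)) (tailSeq b c (k + 1 + i) * a ^ i) := fun i =>
    (summable_shift h1 (k + 1 + i + 1)).hasSum.mul_right _
  have hF : Summable F := by
    refine (summable_prod_of_nonneg hF0).2 ⟨fun i => (hfib i).summable, ?_⟩
    exact (summable_shift h2 (k + 1)).congr fun i => (hfib i).tsum_eq.symm
  calc tailSeq a (tailSeq b c) k = ∑' i, ∑' j, F (i, j) :=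
        tsum_congr fun i => (hfib i).tsum_eq.symm
    _ = ∑' j, ∑' i, F (i, j) := hF.tsum_comm.symm
    _ = tailSeq b (tailSeq a c) k := by
        refine tsum_congr fun j => ?_
        rw [tailSeq, ← tsum_mul_right]
        refine tsum_congr fun i => ?_
        simp only [hF']
        rw [show k + 1 + i + 1 + j = k + 1 + j + 1 + i by ring]
        ring

/-! ### Tail generating functions as iterated divided differences -/

/-- The summand of the tail generating function. -/
noncomputable def tailTerm (v : ℕ → ℝ) (n : ℕ) (s : Fin n → ℝ) (i : Fin n → ℕ) : ℝ :=
  v ((∑ j, i j) + n - 1) * ∏ j, s j ^ i j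

lemma tailTerm_cons (v : ℕ → ℝ) (n : ℕ) (s : Fin (n + 1) → ℝ) (b : ℝ) (i : ℕ)
    (m : Fin (n + 1) → ℕ) :
    tailTerm v (n + 2) (Fin.cons b s) (Fin.cons i m) =
      v ((∑ j, m j) + (n + 1) - 1 + 1 + i) * b ^ i * ∏ j, s j ^ m j := by
  unfold tailTerm
  rw [Fin.sum_univ_succ, Fin.prod_univ_succ]
  simp only [Fin.cons_zero, Fin.cons_succ]
  rw [show i + ∑ j, m j + (n + 2) - 1 = (∑ j, m j) + (n + 1) - 1 + 1 + i by omega, mul_assoc]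

/-- Summing out the first variable is one divided difference at the node `b`. Summability is carried
along because the next application, and the exchange of sums, need it. -/
lemma summable_tailTerm_cons {v : ℕ → ℝ} {n : ℕ} {s : Fin (n + 1) → ℝ} {b : ℝ}
    (hv : ∀ k, 0 ≤ v k) (hs : ∀ j, 0 ≤ s j) (hb : 0 ≤ b) (h1 : Summable fun n => v n * b ^ n)
    (h2 : Summable (tailTerm (tailSeq b v) (n + 1) s)) :
    Summable (tailTerm v (n + 2) (Fin.cons b s)) ∧
      tailGF v (n + 2) (Fin.cons b s) = tailGF (tailSeq b v) (n + 1) s := by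
  let e : (Fin (n + 1) → ℕ) × ℕ ≃ (Fin (n + 2) → ℕ) :=
    (Equiv.prodComm _ _).trans (Fin.consEquiv fun _ => ℕ)
  have he : ∀ z, tailTerm v (n + 2) (Fin.cons b s) (e z) =
      v ((∑ j, z.1 j) + (n + 1) - 1 + 1 + z.2) * b ^ z.2 * ∏ j, s j ^ z.1 j :=
    fun z => tailTerm_cons v n s b z.2 z.1
  have hfib : ∀ m : Fin (n + 1) → ℕ, HasSum
      (fun i => tailTerm v (n + 2) (Fin.cons b s) (e (m, i)))
      (tailTerm (tailSeq b v) (n + 1) s m) := fun m => by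
    simp only [he]
    exact (summable_shift h1 _).hasSum.mul_right _
  have hS : Summable fun z => tailTerm v (n + 2) (Fin.cons b s) (e z) := by
    refine (summable_prod_of_nonneg fun z => ?_).2 ⟨fun m => (hfib m).summable, ?_⟩
    · rw [he]
      exact mul_nonneg (mul_nonneg (hv _) (pow_nonneg hb _))
        (Finset.prod_nonneg fun j _ => pow_nonneg (hs j) _)
    · exact h2.congr fun m => (hfib m).tsum_eq.symm
  refine ⟨e.summable_iff.1 hS, ?_⟩
  change ∑' i, tailTerm v (n + 2) (Fin.cons b s) i = ∑' m, tailTerm (tailSeq b v) (n + 1) s m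
  rw [← e.tsum_eq, hS.tsum_prod' fun m => (hfib m).summable]
  exact tsum_congr fun m => (hfib m).tsum_eq

lemma hasSum_tailTerm_one {v : ℕ → ℝ} {y S : ℝ} (h : HasSum (fun k => v k * y ^ k) S) :
    Summable (tailTerm v 1 ![y]) ∧ tailGF v 1 ![y] = S := by
  have : HasSum (tailTerm v 1 ![y]) S := by
    refine (Equiv.funUnique (Fin 1) ℕ).symm.hasSum_iff.1 (h.congr_fun fun k => ?_)
    simp [tailTerm]
  exact ⟨this.summable, this.tsum_eq⟩

end tailSeq

/-! ### Generating functions with two fixed points -/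

/-- The standing assumptions on a generating function with two fixed points `q < r` and a finite
derivative at `r`. -/
structure HasTwoFixedPoints (p : ℕ → ℝ) (q r : ℝ) : Prop where
  nonneg : ∀ k, 0 ≤ p k
  q_nonneg : 0 ≤ q
  lt : q < r
  fixed_q : HasSum (fun k => p k * q ^ k) q
  fixed_r : HasSum (fun k => p k * r ^ k) r
  deriv_r : Summable (fun k : ℕ => (k : ℝ) * p k * r ^ (k - 1))
  nonlinear : ∃ k, 0 < p (k + 2)

/-- Without coefficients of order at least two `f` is affine, and an affine function with two fixed
points is the identity, which `p 1 ≠ 1` excludes. -/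
lemma hasTwoFixedPoints {p : ℕ → ℝ} {q r : ℝ} (hp : IsOffspringLaw p) (hp1 : p 1 ≠ 1)
    (hqr : IsExtendable p q r)
    (hfr : Summable (fun k : ℕ => (k : ℝ) * p k * r ^ (k - 1))) : HasTwoFixedPoints p q r := by
  refine ⟨hp.nonneg, hqr.nonneg, hqr.lt, hqr.fixed_q, hqr.fixed_r, hfr, ?_⟩
  by_contra! h
  have h0 : ∀ k, p (k + 2) = 0 := fun k => le_antisymm (h k) (hp.nonneg _)
  have hlin : ∀ s, HasSum (fun k => p k * s ^ k) s → s = p 0 + p 1 * s := fun s hs => by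
    have h1 := (hasSum_nat_add_iff' 2).2 hs
    simp only [h0, zero_mul] at h1
    have h2 := h1.unique hasSum_zero
    simp only [Finset.sum_range_succ, Finset.sum_range_zero, pow_zero, pow_one] at h2
    linarith
  have h1 := hlin q hqr.fixed_q
  have h2 := hlin r hqr.fixed_r
  have h3 : (r - q) * (1 - p 1) = 0 := by linear_combination h2 - h1
  rcases mul_eq_zero.1 h3 with h4 | h4
  · linarith [hqr.lt]
  · exact hp1 (by linarith)

/-- The generating function `f s = ∑ p k * s ^ k`. -/
noncomputable def genF (p : ℕ → ℝ) (x : ℝ) : ℝ := ∑' k, p k * x ^ k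

/-- The coefficients of `s ↦ f^{(3)}(q, r, s)`. -/
noncomputable def wSeq (p : ℕ → ℝ) (q r : ℝ) : ℕ → ℝ := tailSeq r (tailSeq q p)

/-- The function `s ↦ f^{(3)}(q, r, s)`. -/
noncomputable def wF (p : ℕ → ℝ) (q r x : ℝ) : ℝ := genF (wSeq p q r) x

namespace HasTwoFixedPoints

variable {p : ℕ → ℝ} {q r x : ℝ}

lemma r_pos (h : HasTwoFixedPoints p q r) : 0 < r := h.q_nonneg.trans_lt h.lt

lemma hasSum_genF (h : HasTwoFixedPoints p q r) (hx : 0 ≤ x) (hxr : x ≤ r) :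
    HasSum (fun k => p k * x ^ k) (genF p x) := by
  refine (Summable.of_nonneg_of_le (fun k => ?_) (fun k => ?_) h.fixed_r.summable).hasSum
  · exact mul_nonneg (h.nonneg k) (pow_nonneg hx k)
  · exact mul_le_mul_of_nonneg_left (pow_le_pow_left₀ hx hxr k) (h.nonneg k)

lemma genF_q (h : HasTwoFixedPoints p q r) : genF p q = q := h.fixed_q.tsum_eq

lemma genF_r (h : HasTwoFixedPoints p q r) : genF p r = r := h.fixed_r.tsum_eq

lemma hasSum_genDeriv (h : HasTwoFixedPoints p q r) (hx : 0 ≤ x) (hxr : x ≤ r) :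
    HasSum (fun k : ℕ => ((k : ℝ) + 1) * p (k + 1) * x ^ k) (genDeriv p x) := by
  have h1 : Summable (fun k : ℕ => (k : ℝ) * p k * x ^ (k - 1)) := by
    refine Summable.of_nonneg_of_le (fun k => ?_) (fun k => ?_) h.deriv_r
    · exact mul_nonneg (mul_nonneg k.cast_nonneg (h.nonneg k)) (pow_nonneg hx _)
    · exact mul_le_mul_of_nonneg_left (pow_le_pow_left₀ hx hxr _)
        (mul_nonneg k.cast_nonneg (h.nonneg k))
  have h2 := (hasSum_nat_add_iff' 1).2 h1.hasSum
  simpa [genDeriv] using h2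

lemma tailSeq_q_nonneg (h : HasTwoFixedPoints p q r) (k : ℕ) : 0 ≤ tailSeq q p k :=
  tailSeq_nonneg h.nonneg h.q_nonneg k

lemma wSeq_nonneg (h : HasTwoFixedPoints p q r) (k : ℕ) : 0 ≤ wSeq p q r k :=
  tailSeq_nonneg h.tailSeq_q_nonneg h.r_pos.le k

lemma hasSum_tailSeq_q (h : HasTwoFixedPoints p q r) (hx : 0 ≤ x) (hxr : x ≤ r) (hxq : x ≠ q) :
    HasSum (fun k => tailSeq q p k * x ^ k) ((genF p x - q) / (x - q)) :=
  hasSum_tailSeq_of_ne h.nonneg h.q_nonneg hx hxq (h.hasSum_genF hx hxr) h.fixed_q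

lemma hasSum_tailSeq_q_q (h : HasTwoFixedPoints p q r) :
    HasSum (fun k => tailSeq q p k * q ^ k) (genDeriv p q) :=
  hasSum_tailSeq_self h.nonneg h.q_nonneg (h.hasSum_genDeriv h.q_nonneg h.lt.le)

lemma hasSum_tailSeq_q_r (h : HasTwoFixedPoints p q r) :
    HasSum (fun k => tailSeq q p k * r ^ k) 1 := by
  have h1 := h.hasSum_tailSeq_q h.r_pos.le le_rfl h.lt.ne'
  rwa [h.genF_r, div_self (sub_ne_zero.2 h.lt.ne')] at h1

lemma hasSum_wSeq (h : HasTwoFixedPoints p q r) (hx : 0 ≤ x) (hxr : x < r) (hxq : x ≠ q) :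
    HasSum (fun k => wSeq p q r k * x ^ k) (((genF p x - q) / (x - q) - 1) / (x - r)) :=
  hasSum_tailSeq_of_ne h.tailSeq_q_nonneg h.r_pos.le hx hxr.ne
    (h.hasSum_tailSeq_q hx hxr.le hxq) h.hasSum_tailSeq_q_r

lemma hasSum_wSeq_q (h : HasTwoFixedPoints p q r) :
    HasSum (fun k => wSeq p q r k * q ^ k) (alphaOf p q / (r - q)) := by
  have h1 := hasSum_tailSeq_of_ne h.tailSeq_q_nonneg h.r_pos.le h.q_nonneg h.lt.ne
    h.hasSum_tailSeq_q_q h.hasSum_tailSeq_q_r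
  rwa [← neg_sub r q, ← neg_sub 1 (genDeriv p q), neg_div_neg_eq] at h1

/-- Taking the node `r` first lets the confluent evaluation at `r` fall on `p` itself, where it is
the known derivative `f' r`. -/
lemma wSeq_comm (h : HasTwoFixedPoints p q r) :
    wSeq p q r = tailSeq q (tailSeq r p) := by
  have hq : Summable fun n => tailSeq q p n * r ^ n := h.hasSum_tailSeq_q_r.summable
  exact tailSeq_comm h.nonneg h.r_pos.le h.q_nonneg h.fixed_q.summable hq

lemma hasSum_wSeq_r (h : HasTwoFixedPoints p q r) :
    HasSum (fun k => wSeq p q r k * r ^ k) (betaOf p r / (r - q)) := by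
  rw [h.wSeq_comm]
  have h1 : HasSum (fun k => tailSeq r p k * q ^ k) 1 := by
    have h2 := hasSum_tailSeq_of_ne h.nonneg h.r_pos.le h.q_nonneg h.lt.ne h.fixed_q h.fixed_r
    rwa [div_self (sub_ne_zero.2 h.lt.ne)] at h2
  have h2 : HasSum (fun k => tailSeq r p k * r ^ k) (genDeriv p r) :=
    hasSum_tailSeq_self h.nonneg h.r_pos.le (h.hasSum_genDeriv h.r_pos.le le_rfl)
  exact hasSum_tailSeq_of_ne (fun k => tailSeq_nonneg h.nonneg h.r_pos.le k) h.q_nonneg h.r_pos.le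
    h.lt.ne' h2 h1

lemma hasSum_wF (h : HasTwoFixedPoints p q r) (hx : 0 ≤ x) (hxr : x ≤ r) :
    HasSum (fun k => wSeq p q r k * x ^ k) (wF p q r x) := by
  refine (Summable.of_nonneg_of_le (fun k => ?_) (fun k => ?_) h.hasSum_wSeq_r.summable).hasSum
  · exact mul_nonneg (h.wSeq_nonneg k) (pow_nonneg hx k)
  · exact mul_le_mul_of_nonneg_left (pow_le_pow_left₀ hx hxr k) (h.wSeq_nonneg k)

lemma wF_q (h : HasTwoFixedPoints p q r) : wF p q r q = alphaOf p q / (r - q) :=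
  h.hasSum_wSeq_q.tsum_eq

lemma wF_r (h : HasTwoFixedPoints p q r) : wF p q r r = betaOf p r / (r - q) :=
  h.hasSum_wSeq_r.tsum_eq

/-- The factorisation of the vector field `f x - x` on which everything rests. The two nodes are
treated apart because the divided differences divide by `x - q` and `x - r`. -/
lemma genF_eq (h : HasTwoFixedPoints p q r) (hx : 0 ≤ x) (hxr : x ≤ r) :
    genF p x = x + (x - q) * (x - r) * wF p q r x := by
  rcases eq_or_ne x q with rfl | hxq
  · rw [h.genF_q]; ring
  rcases hxr.eq_or_lt with rfl | hxr
  · rw [h.genF_r]; ring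
  have h1 : wF p q r x = _ := (h.hasSum_wSeq hx hxr hxq).tsum_eq
  have h2 : x - q ≠ 0 := sub_ne_zero.2 hxq
  have h3 : x - r ≠ 0 := sub_ne_zero.2 hxr.ne
  rw [h1]
  field_simp
  ring

/-- The constant coefficient dominates `p (k + 2) * r ^ k` for every `k`, and some `p (k + 2)` is
positive. -/
lemma wSeq_zero_pos (h : HasTwoFixedPoints p q r) : 0 < wSeq p q r 0 := by
  obtain ⟨k, hk⟩ := h.nonlinear
  have h1 : Summable fun i => tailSeq q p (0 + 1 + i) * r ^ i :=
    summable_shift h.hasSum_tailSeq_q_r.summable _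
  have h2 : p (k + 2) ≤ tailSeq q p (0 + 1 + k) := by
    have := (summable_shift h.fixed_q.summable (0 + 1 + k + 1)).le_tsum 0
      (fun j _ => mul_nonneg (h.nonneg _) (pow_nonneg h.q_nonneg _))
    simp only [add_zero, pow_zero, mul_one] at this
    rw [show 0 + 1 + k + 1 = k + 2 by ring] at this
    rwa [tailSeq, show 0 + 1 + k + 1 = k + 2 by ring]
  refine lt_of_lt_of_le ?_ (h1.le_tsum k
    (fun j _ => mul_nonneg (h.tailSeq_q_nonneg _) (pow_nonneg h.r_pos.le _)))
  exact mul_pos (hk.trans_le h2) (pow_pos h.r_pos _)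

lemma wF_pos (h : HasTwoFixedPoints p q r) (hx : 0 ≤ x) (hxr : x ≤ r) : 0 < wF p q r x := by
  refine h.wSeq_zero_pos.trans_le ?_
  have := (h.hasSum_wF hx hxr).summable.le_tsum 0
    (fun j _ => mul_nonneg (h.wSeq_nonneg j) (pow_nonneg hx j))
  simpa [wF, genF] using this

lemma alpha_pos (h : HasTwoFixedPoints p q r) : 0 < alphaOf p q := by
  have h1 := h.wF_pos h.q_nonneg h.lt.le
  rw [h.wF_q] at h1
  exact (div_pos_iff_of_pos_right (sub_pos.2 h.lt)).1 h1

lemma beta_pos (h : HasTwoFixedPoints p q r) : 0 < betaOf p r := by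
  have h1 := h.wF_pos h.r_pos.le le_rfl
  rw [h.wF_r] at h1
  exact (div_pos_iff_of_pos_right (sub_pos.2 h.lt)).1 h1

lemma gamma_pos (h : HasTwoFixedPoints p q r) : 0 < gammaOf p q r :=
  div_pos h.alpha_pos h.beta_pos

/-- This relation makes the residues in the partial fractions match, and it explains the factor `γ`
in `ψ`. -/
lemma gamma_mul_wF_r (h : HasTwoFixedPoints p q r) :
    gammaOf p q r * wF p q r r = wF p q r q := by
  have h1 := h.beta_pos.ne'
  rw [h.wF_q, h.wF_r, gammaOf]
  field_simp

lemma summable_tailSeq_q_wSeq (h : HasTwoFixedPoints p q r) (hx : 0 ≤ x) (hxr : x ≤ r) :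
    Summable fun k => tailSeq q (wSeq p q r) k * x ^ k := by
  refine Summable.of_nonneg_of_le (fun k => ?_) (fun k => ?_)
    (hasSum_tailSeq_of_ne h.wSeq_nonneg h.q_nonneg h.r_pos.le h.lt.ne'
    (h.hasSum_wF h.r_pos.le le_rfl) (h.hasSum_wF h.q_nonneg h.lt.le)).summable
  · exact mul_nonneg (tailSeq_nonneg h.wSeq_nonneg h.q_nonneg k) (pow_nonneg hx k)
  · exact mul_le_mul_of_nonneg_left (pow_le_pow_left₀ hx hxr k)
      (tailSeq_nonneg h.wSeq_nonneg h.q_nonneg k)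

/-- The endpoint `x = r` is excluded: there the sum would involve `f'' r`, which may be infinite. -/
lemma hasSum_tailSeq_r_wSeq (h : HasTwoFixedPoints p q r) (hx : 0 ≤ x) (hxr : x < r) :
    HasSum (fun k => tailSeq r (wSeq p q r) k * x ^ k)
      ((wF p q r x - wF p q r r) / (x - r)) :=
  hasSum_tailSeq_of_ne h.wSeq_nonneg h.r_pos.le hx hxr.ne
    (h.hasSum_wF hx hxr.le) (h.hasSum_wF h.r_pos.le le_rfl)

lemma tailGF_three (h : HasTwoFixedPoints p q r) (hx : 0 ≤ x) (hxr : x ≤ r) :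
    tailGF p 3 ![q, r, x] = wF p q r x := by
  have h1 := hasSum_tailTerm_one (h.hasSum_wF hx hxr)
  have h2 := summable_tailTerm_cons (s := ![x]) h.tailSeq_q_nonneg (by simpa) h.r_pos.le
    h.hasSum_tailSeq_q_r.summable h1.1
  have h3 := summable_tailTerm_cons (s := ![r, x]) h.nonneg
    (by simp [Fin.forall_fin_succ, h.r_pos.le, hx]) h.q_nonneg h.fixed_q.summable h2.1
  exact h3.2.trans (h2.2.trans h1.2)

lemma tailGF_four_qrrx (h : HasTwoFixedPoints p q r) (hx : 0 ≤ x) (hxr : x < r) :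
    tailGF p 4 ![q, r, r, x] = (wF p q r x - wF p q r r) / (x - r) := by
  have h0 := hasSum_tailTerm_one (h.hasSum_tailSeq_r_wSeq hx hxr)
  have h1 := summable_tailTerm_cons (s := ![x]) h.wSeq_nonneg (by simpa) h.r_pos.le
    h.hasSum_wSeq_r.summable h0.1
  have h2 := summable_tailTerm_cons (s := ![r, x]) h.tailSeq_q_nonneg
    (by simp [Fin.forall_fin_succ, h.r_pos.le, hx]) h.r_pos.le
    h.hasSum_tailSeq_q_r.summable h1.1
  have h3 := summable_tailTerm_cons (s := ![r, r, x]) h.nonneg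
    (by simp [Fin.forall_fin_succ, h.r_pos.le, hx]) h.q_nonneg
    h.fixed_q.summable h2.1
  exact h3.2.trans (h2.2.trans (h1.2.trans h0.2))

lemma tailSeq_q_wSeq (h : HasTwoFixedPoints p q r) :
    tailSeq q (wSeq p q r) = tailSeq r (tailSeq q (tailSeq q p)) :=
  tailSeq_comm h.tailSeq_q_nonneg h.q_nonneg h.r_pos.le h.hasSum_tailSeq_q_r.summable
    h.hasSum_wSeq_q.summable

lemma tailGF_four_qqrx (h : HasTwoFixedPoints p q r) (hx : 0 ≤ x) (hxr : x ≤ r) :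
    tailGF p 4 ![q, q, r, x] = genF (tailSeq q (wSeq p q r)) x := by
  have hx' := (h.summable_tailSeq_q_wSeq hx hxr).hasSum
  rw [h.tailSeq_q_wSeq] at hx'
  have huu : Summable fun k => tailSeq q (tailSeq q p) k * r ^ k :=
    (hasSum_tailSeq_of_ne h.tailSeq_q_nonneg h.q_nonneg h.r_pos.le h.lt.ne' h.hasSum_tailSeq_q_r
      h.hasSum_tailSeq_q_q).summable
  have h0 := hasSum_tailTerm_one hx'
  have h1 := summable_tailTerm_cons (s := ![x])
    (tailSeq_nonneg h.tailSeq_q_nonneg h.q_nonneg) (by simpa) h.r_pos.le huu h0.1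
  have h2 := summable_tailTerm_cons (s := ![r, x]) h.tailSeq_q_nonneg
    (by simp [Fin.forall_fin_succ, h.r_pos.le, hx]) h.q_nonneg
    h.hasSum_tailSeq_q_q.summable h1.1
  have h3 := summable_tailTerm_cons (s := ![q, r, x]) h.nonneg
    (by simp [Fin.forall_fin_succ, h.r_pos.le, h.q_nonneg, hx]) h.q_nonneg
    h.fixed_q.summable h2.1
  rw [h.tailSeq_q_wSeq]
  exact h3.2.trans (h2.2.trans (h1.2.trans h0.2))

lemma sub_mul_tailGF_qqrx (h : HasTwoFixedPoints p q r) (hx : 0 ≤ x) (hxr : x ≤ r) :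
    (x - q) * tailGF p 4 ![q, q, r, x] = wF p q r x - wF p q r q := by
  rcases eq_or_ne x q with rfl | hxq
  · ring
  rw [h.tailGF_four_qqrx hx hxr]
  have h1 : genF (tailSeq q (wSeq p q r)) x = _ :=
    (hasSum_tailSeq_of_ne h.wSeq_nonneg h.q_nonneg hx hxq (h.hasSum_wF hx hxr)
      (h.hasSum_wF h.q_nonneg h.lt.le)).tsum_eq
  rw [h1, mul_div_cancel₀ _ (sub_ne_zero.2 hxq)]

lemma continuousOn_genF {c : ℕ → ℝ} {ρ : ℝ} (hc : Summable fun k => c k * ρ ^ k)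
    (hc0 : ∀ k, 0 ≤ c k) : ContinuousOn (genF c) (Set.Icc 0 ρ) := by
  refine continuousOn_tsum (fun k => by fun_prop) hc fun k x hx => ?_
  rw [Real.norm_of_nonneg (mul_nonneg (hc0 k) (pow_nonneg hx.1 k))]
  exact mul_le_mul_of_nonneg_left (pow_le_pow_left₀ hx.1 hx.2 k) (hc0 k)

lemma continuousOn_wF (h : HasTwoFixedPoints p q r) : ContinuousOn (wF p q r) (Set.Icc 0 r) :=
  continuousOn_genF h.hasSum_wSeq_r.summable h.wSeq_nonneg

/-- The term with the double node `q` is kept as a power series, so nothing happens at `x = q`; the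
term with the double node `r` is a quotient that degenerates only at `x = r`. -/
lemma continuousOn_psi (h : HasTwoFixedPoints p q r) : ContinuousOn (psi p q r) (Set.Ico 0 r) := by
  have hsub : Set.Ico 0 r ⊆ Set.Icc 0 r := Set.Ico_subset_Icc_self
  have h1 : ContinuousOn (fun x => (genF (tailSeq q (wSeq p q r)) x -
      gammaOf p q r * ((wF p q r x - wF p q r r) / (x - r))) / wF p q r x) (Set.Ico 0 r) := by
    have hW := h.continuousOn_wF.mono hsub
    refine ContinuousOn.div (ContinuousOn.sub ?_ (continuousOn_const.mul ?_)) hW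
      fun x hx => (h.wF_pos hx.1 hx.2.le).ne'
    · exact (continuousOn_genF (h.summable_tailSeq_q_wSeq h.r_pos.le le_rfl)
        (tailSeq_nonneg h.wSeq_nonneg h.q_nonneg)).mono hsub
    · exact (hW.sub continuousOn_const).div (by fun_prop) fun x hx => sub_ne_zero.2 hx.2.ne
  refine h1.congr fun x hx => ?_
  rw [psi, h.tailGF_three hx.1 hx.2.le, h.tailGF_four_qqrx hx.1 hx.2.le,
    h.tailGF_four_qrrx hx.1 hx.2]

/-- The logarithmic derivative of `K` times `x - q`. -/
lemma one_add_sub_mul_psi (h : HasTwoFixedPoints p q r) (hx : 0 ≤ x) (hxr : x < r) :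
    1 + (x - q) * (gammaOf p q r / (r - x) - psi p q r x) =
      alphaOf p q / ((r - x) * wF p q r x) := by
  have hW := (h.wF_pos hx hxr.le).ne'
  have hrx : r - x ≠ 0 := (sub_pos.2 hxr).ne'
  have hxr' : x - r ≠ 0 := sub_ne_zero.2 hxr.ne
  have hrq : r - q ≠ 0 := sub_ne_zero.2 h.lt.ne'
  have h1 := h.sub_mul_tailGF_qqrx hx hxr.le
  have h2 := h.gamma_mul_wF_r
  have h3 : alphaOf p q = wF p q r q * (r - q) := by rw [h.wF_q, div_mul_cancel₀ _ hrq]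
  rw [psi, h.tailGF_three hx hxr.le, h.tailGF_four_qrrx hx hxr, h3, ← neg_sub r x]
  rw [← neg_sub r x] at hxr'
  field_simp
  linear_combination (-(r - x)) * h1 + (x - q) * h2

/-- A nonnegative sequence `v` with `∑ v k * r ^ k < ∞` decays faster than any polynomial against
`q ^ k` for `q < r`. -/
lemma summable_sq_mul {v : ℕ → ℝ} (hq : 0 ≤ q) (hqr : q < r) (hv : ∀ k, 0 ≤ v k)
    (hr : Summable fun k => v k * r ^ k) :
    Summable fun k : ℕ => ((k : ℝ) + 1) ^ 2 * v k * q ^ k := by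
  have hr0 : 0 < r := hq.trans_lt hqr
  have h0 : Summable fun k : ℕ => ((k : ℝ) + 1) ^ 2 * (q / r) ^ k := by
    have hn : ‖q / r‖ < 1 := by
      rw [Real.norm_of_nonneg (div_nonneg hq hr0.le), div_lt_one hr0]
      exact hqr
    have h2 := summable_pow_mul_geometric_of_norm_lt_one 2 hn
    have h1 := summable_pow_mul_geometric_of_norm_lt_one 1 hn
    have h3 := summable_pow_mul_geometric_of_norm_lt_one 0 hn
    refine ((h2.add (h1.mul_left 2)).add h3).congr fun k => by ring
  refine Summable.of_nonneg_of_le (fun k => ?_) (fun k => ?_)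
    (h0.mul_left (∑' k, v k * r ^ k))
  · exact mul_nonneg (mul_nonneg (sq_nonneg _) (hv k)) (pow_nonneg hq k)
  · have h1 := hr.le_tsum k (fun j _ => mul_nonneg (hv j) (pow_nonneg hr0.le j))
    have h2 : ((k : ℝ) + 1) ^ 2 * v k * q ^ k =
        (v k * r ^ k) * (((k : ℝ) + 1) ^ 2 * (q / r) ^ k) := by
      rw [div_pow]
      field_simp
    rw [h2]
    exact mul_le_mul_of_nonneg_right h1
      (mul_nonneg (sq_nonneg _) (pow_nonneg (div_nonneg hq hr0.le) k))

lemma summable_mul_of_le_sq {v : ℕ → ℝ} {g : ℕ → ℝ} (hq : 0 ≤ q) (hqr : q < r)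
    (hv : ∀ k, 0 ≤ v k) (hr : Summable fun k => v k * r ^ k)
    (hg0 : ∀ k, 0 ≤ g k) (hg : ∀ k, g k ≤ ((k : ℝ) + 1) ^ 2) :
    Summable fun k : ℕ => g k * v k * q ^ k := by
  refine Summable.of_nonneg_of_le (fun k => ?_) (fun k => ?_) (summable_sq_mul hq hqr hv hr)
  · exact mul_nonneg (mul_nonneg (hg0 k) (hv k)) (pow_nonneg hq k)
  · exact mul_le_mul_of_nonneg_right (mul_le_mul_of_nonneg_right (hg k) (hv k)) (pow_nonneg hq k)

/-- Differentiating `f x - x = (x - q) * (x - r) * w x` twice at `q` gives `f'' q = 2 * (w q + (q -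
r) * w' q)`. The computation is done on coefficients through `tailSeq_eq`. -/
lemma genDeriv₂_q (h : HasTwoFixedPoints p q r) :
    genDeriv₂ p q = 2 * (wF p q r q + (q - r) * genF (tailSeq q (wSeq p q r)) q) := by
  have hq := h.q_nonneg
  set u := tailSeq q p with hu
  set w := wSeq p q r with hw
  have hu0 : ∀ k, 0 ≤ u k := h.tailSeq_q_nonneg
  have hur : Summable fun k => u k * r ^ k := h.hasSum_tailSeq_q_r.summable
  have hur1 : Summable fun k => u (k + 1) * r ^ k :=
    (summable_shift hur 1).congr fun k => by rw [add_comm]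
  have hw0 : ∀ k, 0 ≤ w k := h.wSeq_nonneg
  have hwr : Summable fun k => w k * r ^ k := h.hasSum_wSeq_r.summable
  have hwr1 : Summable fun k => w (k + 1) * r ^ k :=
    (summable_shift hwr 1).congr fun k => by rw [add_comm]
  have hpu : ∀ k, p (k + 1) = u k - q * u (k + 1) := fun k => by
    have := tailSeq_eq h.fixed_q.summable k
    rw [hu]; linarith
  have huw : ∀ k, u (k + 1) = w k - r * w (k + 1) := fun k => by
    have := tailSeq_eq hur k
    rw [hw, wSeq, ← hu]; linarith
  have hk0 : ∀ k : ℕ, (0 : ℝ) ≤ k := fun k => k.cast_nonneg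
  have hA : HasSum (fun k : ℕ => ((k : ℝ) + 1) * w (k + 1) * q ^ k)
      (genF (tailSeq q w) q) := by
    have h1 : Summable (fun k : ℕ => ((k : ℝ) + 1) * w (k + 1) * q ^ k) :=
      summable_mul_of_le_sq (v := fun k => w (k + 1)) hq h.lt (fun k => hw0 _) hwr1
        (fun k => by linarith [hk0 k]) (fun k => by nlinarith [hk0 k])
    have h2 : genF (tailSeq q w) q = _ := (hasSum_tailSeq_self hw0 hq h1.hasSum).tsum_eq
    rw [h2]
    exact h1.hasSum
  have hW : HasSum (fun k : ℕ => w k * q ^ k) (wF p q r q) := h.hasSum_wF hq h.lt.le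
  have hU : HasSum (fun k : ℕ => ((k : ℝ) + 1) * u (k + 1) * q ^ k)
      (wF p q r q + (q - r) * genF (tailSeq q w) q) := by
    have h1 : HasSum (fun k : ℕ => (k : ℝ) * w k * q ^ k) (q * genF (tailSeq q w) q) := by
      refine (hasSum_nat_add_iff' 1).1 ?_
      simp only [Finset.range_one, Finset.sum_singleton, Nat.cast_zero, zero_mul, sub_zero]
      refine (hA.mul_left q).congr_fun fun k => ?_
      push_cast
      ring
    have h2 := (hW.add h1).sub (hA.mul_left r)
    rw [show wF p q r q + (q - r) * genF (tailSeq q w) q =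
      wF p q r q + q * genF (tailSeq q w) q - r * genF (tailSeq q w) q by ring]
    refine h2.congr_fun fun k => ?_
    rw [huw]
    ring
  -- Substituting `p (k + 2) = u (k + 1) - q * u (k + 2)` into half of `f'' q` and shifting the
  -- second sum leaves the weights `(k + 1)(k + 2)/2 - k(k + 1)/2 = k + 1`, which is the series
  -- `hU`.
  have hB : Summable (fun k : ℕ => ((k : ℝ) + 1) * ((k : ℝ) + 2) / 2 * u (k + 1) * q ^ k) :=
    summable_mul_of_le_sq (v := fun k => u (k + 1)) hq h.lt (fun k => hu0 _) hur1
      (fun k => by have := hk0 k; positivity) (fun k => by nlinarith [hk0 k])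
  have hC : HasSum (fun k : ℕ => (k : ℝ) * ((k : ℝ) + 1) / 2 * u (k + 1) * q ^ k)
      (∑' k : ℕ, ((k : ℝ) + 1) * ((k : ℝ) + 2) / 2 * u (k + 1) * q ^ k -
        (wF p q r q + (q - r) * genF (tailSeq q w) q)) := by
    refine (hB.hasSum.sub hU).congr_fun fun k => ?_
    ring
  have hC' := (hasSum_nat_add_iff' 1).2 hC
  simp only [Finset.range_one, Finset.sum_singleton, Nat.cast_zero, zero_mul, sub_zero,
    zero_div] at hC'
  have hP : HasSum (fun k : ℕ => ((k : ℝ) + 1) * ((k : ℝ) + 2) / 2 * p (k + 2) * q ^ k)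
      (wF p q r q + (q - r) * genF (tailSeq q w) q) := by
    have h1 := hB.hasSum.sub hC'
    rw [sub_sub_cancel] at h1
    refine h1.congr_fun fun k => ?_
    rw [hpu]
    push_cast
    ring
  have hP' : HasSum (fun k : ℕ => (k : ℝ) * ((k : ℝ) - 1) * p k * q ^ (k - 2))
      (2 * (wF p q r q + (q - r) * genF (tailSeq q w) q)) := by
    refine (hasSum_nat_add_iff' 2).1 ?_
    simp only [Finset.sum_range_succ, Finset.sum_range_zero, Nat.cast_zero, Nat.cast_one,
      zero_mul, sub_self, mul_zero, add_zero, sub_zero]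
    refine (hP.mul_left 2).congr_fun fun k => ?_
    rw [Nat.add_sub_cancel]
    push_cast
    ring
  exact hP'.tsum_eq

/-- The left side is the logarithmic derivative of `K x / (x - q)` at `q`; the constant of the
second-order term of the survival probability comes from here. -/
lemma gamma_div_sub_psi_q (h : HasTwoFixedPoints p q r) :
    gammaOf p q r / (r - q) - psi p q r q = genDeriv₂ p q / (2 * alphaOf p q) := by
  have hW := (h.wF_pos h.q_nonneg h.lt.le).ne'
  have hrq : r - q ≠ 0 := sub_ne_zero.2 h.lt.ne'
  have hqr : q - r ≠ 0 := sub_ne_zero.2 h.lt.ne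
  have h2 := h.gamma_mul_wF_r
  have h3 : alphaOf p q = wF p q r q * (r - q) := by rw [h.wF_q, div_mul_cancel₀ _ hrq]
  rw [psi, h.tailGF_three h.q_nonneg h.lt.le, h.tailGF_four_qrrx h.q_nonneg h.lt,
    h.tailGF_four_qqrx h.q_nonneg h.lt.le, h.genDeriv₂_q, h3, ← neg_sub r q]
  rw [← neg_sub r q] at hqr
  field_simp
  linear_combination h2

end HasTwoFixedPoints

/-! ### The function `K` and the flow it linearises -/

/-- The quotient `K s / (s - q)`. -/
noncomputable def facE (p : ℕ → ℝ) (q r x : ℝ) : ℝ :=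
  (r - q) ^ gammaOf p q r * (r - x) ^ (-gammaOf p q r) *
    Real.exp (∫ y in x..q, psi p q r (max y 0))

/-- The function `K`, continued to negative arguments. -/
noncomputable def kF (p : ℕ → ℝ) (q r x : ℝ) : ℝ := (x - q) * facE p q r x

/-- The flow of the differential equation `y' = f y - y`. -/
noncomputable def flow (p : ℕ → ℝ) (q r : ℝ) (t s : ℝ) : ℝ :=
  Function.invFunOn (kF p q r) (Set.Ico 0 r) (Real.exp (-alphaOf p q * t) * kF p q r s)

namespace HasTwoFixedPoints

variable {p : ℕ → ℝ} {q r x s t : ℝ}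

lemma q_mem (h : HasTwoFixedPoints p q r) : q ∈ Set.Ico 0 r := ⟨h.q_nonneg, h.lt⟩

lemma K_eq_kF (h : HasTwoFixedPoints p q r) (hx : 0 ≤ x) : K p q r x = kF p q r x := by
  have h1 : ∫ y in x..q, psi p q r y = ∫ y in x..q, psi p q r (max y 0) := by
    refine intervalIntegral.integral_congr fun y hy => ?_
    have : 0 ≤ y := (le_min hx h.q_nonneg).trans hy.1
    simp only [max_eq_left this]
  rw [K, kF, facE, h1]
  ring

/-- Freezing `ψ` to the left of `0` makes the integrand continuous on an open set, so that `K` has a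
two-sided derivative even at `0`. -/
lemma continuousOn_psi_max (h : HasTwoFixedPoints p q r) :
    ContinuousOn (fun y => psi p q r (max y 0)) (Set.Iio r) :=
  h.continuousOn_psi.comp (by fun_prop) fun y hy => ⟨le_max_right _ _, max_lt hy h.r_pos⟩

lemma facE_pos (h : HasTwoFixedPoints p q r) (hxr : x < r) : 0 < facE p q r x :=
  mul_pos (mul_pos (Real.rpow_pos_of_pos (sub_pos.2 h.lt) _)
    (Real.rpow_pos_of_pos (sub_pos.2 hxr) _)) (Real.exp_pos _)

lemma facE_q (h : HasTwoFixedPoints p q r) : facE p q r q = 1 := by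
  rw [facE, intervalIntegral.integral_same, Real.exp_zero, mul_one,
    ← Real.rpow_add (sub_pos.2 h.lt), add_neg_cancel, Real.rpow_zero]

lemma hasDerivAt_facE (h : HasTwoFixedPoints p q r) (hx : 0 ≤ x) (hxr : x < r) :
    HasDerivAt (facE p q r)
      (facE p q r x * (gammaOf p q r / (r - x) - psi p q r x)) x := by
  have hrx : 0 < r - x := sub_pos.2 hxr
  have hcont := h.continuousOn_psi_max
  have hint : HasDerivAt (fun u => ∫ y in u..q, psi p q r (max y 0)) (-psi p q r (max x 0)) x := by
    refine intervalIntegral.integral_hasDerivAt_left ?_ ?_ ?_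
    · refine (hcont.mono fun y hy => ?_).intervalIntegrable
      exact hy.2.trans_lt (max_lt hxr h.lt)
    · exact hcont.stronglyMeasurableAtFilter isOpen_Iio x hxr
    · exact hcont.continuousAt (isOpen_Iio.mem_nhds hxr)
  rw [max_eq_left hx] at hint
  have h1 : HasDerivAt (fun y => (r - y) ^ (-gammaOf p q r))
      (-1 * (-gammaOf p q r) * (r - x) ^ (-gammaOf p q r - 1)) x :=
    ((hasDerivAt_id x).const_sub r).rpow_const (Or.inl hrx.ne')
  refine ((h1.const_mul ((r - q) ^ gammaOf p q r)).mul hint.exp).congr_deriv ?_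
  rw [Real.rpow_sub_one hrx.ne', facE]
  field_simp
  ring

lemma kF_q : kF p q r q = 0 := by simp [kF]

/-- With `genF_eq` this says `K' x * (f x - x) = -α * K x`, so `K` linearises the flow. In this form
there is no division by `x - q`, and positivity is visible. -/
lemma hasDerivAt_kF (h : HasTwoFixedPoints p q r) (hx : 0 ≤ x) (hxr : x < r) :
    HasDerivAt (kF p q r)
      (facE p q r x * (alphaOf p q / ((r - x) * wF p q r x))) x := by
  refine (((hasDerivAt_id x).sub_const q).mul (h.hasDerivAt_facE hx hxr)).congr_deriv ?_
  rw [← h.one_add_sub_mul_psi hx hxr]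
  simp only [id]
  ring

lemma deriv_kF_pos (h : HasTwoFixedPoints p q r) (hx : 0 ≤ x) (hxr : x < r) :
    0 < facE p q r x * (alphaOf p q / ((r - x) * wF p q r x)) :=
  mul_pos (h.facE_pos hxr) (div_pos h.alpha_pos (mul_pos (sub_pos.2 hxr) (h.wF_pos hx hxr.le)))

lemma continuousOn_kF (h : HasTwoFixedPoints p q r) : ContinuousOn (kF p q r) (Set.Ico 0 r) :=
  fun _ hx => (h.hasDerivAt_kF hx.1 hx.2).continuousAt.continuousWithinAt

lemma strictMonoOn_kF (h : HasTwoFixedPoints p q r) : StrictMonoOn (kF p q r) (Set.Ico 0 r) := by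
  refine strictMonoOn_of_deriv_pos (convex_Ico 0 r) h.continuousOn_kF fun x hx => ?_
  have hx' := interior_subset hx
  rw [(h.hasDerivAt_kF hx'.1 hx'.2).deriv]
  exact h.deriv_kF_pos hx'.1 hx'.2

/-- The target lies between `K q = 0` and `K s`, so the intermediate value theorem applies between
`q` and `s`. -/
lemma exists_kF_eq (h : HasTwoFixedPoints p q r) (ht : 0 ≤ t) (hs : s ∈ Set.Ico 0 r) :
    ∃ y ∈ Set.Ico 0 r, kF p q r y = Real.exp (-alphaOf p q * t) * kF p q r s := by
  have hsub : Set.uIcc q s ⊆ Set.Ico 0 r := fun y hy =>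
    ⟨(le_min h.q_nonneg hs.1).trans hy.1, hy.2.trans_lt (max_lt h.lt hs.2)⟩
  have he0 := Real.exp_pos (-alphaOf p q * t)
  have he1 : Real.exp (-alphaOf p q * t) ≤ 1 := by
    rw [Real.exp_le_one_iff, neg_mul]
    exact neg_nonpos.2 (mul_nonneg h.alpha_pos.le ht)
  obtain ⟨y, hy, hy'⟩ := intermediate_value_uIcc (h.continuousOn_kF.mono hsub)
    (show Real.exp (-alphaOf p q * t) * kF p q r s ∈ _ by
      rw [kF_q, Set.mem_uIcc]
      rcases le_total 0 (kF p q r s) with h0 | h0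
      · exact Or.inl ⟨mul_nonneg he0.le h0, mul_le_of_le_one_left h0 he1⟩
      · exact Or.inr ⟨by nlinarith, mul_nonpos_of_nonneg_of_nonpos he0.le h0⟩)
  exact ⟨y, hsub hy, hy'⟩

lemma flow_mem (h : HasTwoFixedPoints p q r) (ht : 0 ≤ t) (hs : s ∈ Set.Ico 0 r) :
    flow p q r t s ∈ Set.Ico 0 r :=
  Function.invFunOn_mem (h.exists_kF_eq ht hs)

lemma kF_flow (h : HasTwoFixedPoints p q r) (ht : 0 ≤ t) (hs : s ∈ Set.Ico 0 r) :
    kF p q r (flow p q r t s) = Real.exp (-alphaOf p q * t) * kF p q r s :=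
  Function.invFunOn_eq (h.exists_kF_eq ht hs)

lemma flow_zero (h : HasTwoFixedPoints p q r) (hs : s ∈ Set.Ico 0 r) : flow p q r 0 s = s := by
  refine h.strictMonoOn_kF.injOn (h.flow_mem le_rfl hs) hs ?_
  simp [h.kF_flow le_rfl hs]

lemma flow_lt_flow (h : HasTwoFixedPoints p q r) (ht : 0 ≤ t) {s' : ℝ} (hs : s ∈ Set.Ico 0 r)
    (hs' : s' ∈ Set.Ico 0 r) (hlt : s < s') : flow p q r t s < flow p q r t s' := by
  refine (h.strictMonoOn_kF.lt_iff_lt (h.flow_mem ht hs) (h.flow_mem ht hs')).1 ?_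
  rw [h.kF_flow ht hs, h.kF_flow ht hs']
  exact mul_lt_mul_of_pos_left (h.strictMonoOn_kF hs hs' hlt) (Real.exp_pos _)

/-- Continuity of the inverse of a strictly increasing function, checked on order bounds; bounds
outside `[0, r)` hold trivially. -/
lemma tendsto_of_tendsto_kF (h : HasTwoFixedPoints p q r) {ι : Type*} {l : Filter ι} {g : ι → ℝ}
    (hx : x ∈ Set.Ico 0 r) (hg : ∀ᶠ i in l, g i ∈ Set.Ico 0 r)
    (hk : Tendsto (fun i => kF p q r (g i)) l (𝓝 (kF p q r x))) : Tendsto g l (𝓝 x) := by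
  refine tendsto_order.2 ⟨fun a ha => ?_, fun b hb => ?_⟩
  · rcases lt_or_ge a 0 with h0 | h0
    · filter_upwards [hg] with i hi using h0.trans_le hi.1
    · have haI : a ∈ Set.Ico 0 r := ⟨h0, ha.trans hx.2⟩
      filter_upwards [hg, hk.eventually (lt_mem_nhds (h.strictMonoOn_kF haI hx ha))] with i hi hi'
      exact (h.strictMonoOn_kF.lt_iff_lt haI hi).1 hi'
  · rcases lt_or_ge b r with h0 | h0
    · have hbI : b ∈ Set.Ico 0 r := ⟨hx.1.trans hb.le, h0⟩
      filter_upwards [hg, hk.eventually (gt_mem_nhds (h.strictMonoOn_kF hx hbI hb))] with i hi hi'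
      exact (h.strictMonoOn_kF.lt_iff_lt hi hbI).1 hi'
    · filter_upwards [hg] with i hi using hi.2.trans_le h0

lemma continuousOn_flow (h : HasTwoFixedPoints p q r) (hs : s ∈ Set.Ico 0 r) :
    ContinuousOn (fun t => flow p q r t s) (Set.Ici 0) := by
  intro t ht
  refine h.tendsto_of_tendsto_kF (h.flow_mem ht hs) ?_ ?_
  · filter_upwards [self_mem_nhdsWithin] with u hu using h.flow_mem hu hs
  · rw [h.kF_flow ht hs]
    have h1 : Continuous fun u => Real.exp (-alphaOf p q * u) * kF p q r s := by fun_prop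
    refine (h1.continuousWithinAt (s := Set.Ici 0)).tendsto.congr' ?_
    filter_upwards [self_mem_nhdsWithin] with u hu using (h.kF_flow hu hs).symm

lemma hasDerivWithinAt_flow (h : HasTwoFixedPoints p q r) (hs : s ∈ Set.Ico 0 r) (ht : 0 ≤ t) :
    HasDerivWithinAt (fun t => flow p q r t s)
      (genF p (flow p q r t s) - flow p q r t s) (Set.Ici t) t := by
  set y := flow p q r t s with hy
  have hyI : y ∈ Set.Ico 0 r := h.flow_mem ht hs
  have hD := h.hasDerivAt_kF hyI.1 hyI.2
  have hpos := h.deriv_kF_pos hyI.1 hyI.2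
  set D := facE p q r y * (alphaOf p q / ((r - y) * wF p q r y)) with hDdef
  have h1 : HasDerivAt (fun u => Real.exp (-alphaOf p q * u) * kF p q r s)
      (-alphaOf p q * kF p q r y) t := by
    have h2 := (((hasDerivAt_id t).const_mul (-alphaOf p q)).exp).mul_const (kF p q r s)
    refine h2.congr_deriv ?_
    rw [hy, h.kF_flow ht hs]
    simp only [id]
    ring
  have hcont : Tendsto (fun t => flow p q r t s) (𝓝[Set.Ici t] t) (𝓝[Set.univ] y) := by
    rw [nhdsWithin_univ]
    exact (h.continuousOn_flow hs t ht).mono (Set.Ici_subset_Ici.2 ht)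
  -- The chain rule read backwards: the composite `K ∘ φ` is an explicit exponential and `K' ≠ 0`,
  -- so `φ` is differentiable with the quotient as derivative.
  have h3 := HasFDerivWithinAt.of_comp_of_leftInverse (s := Set.Ici t)
    (f'symm := ContinuousLinearMap.toSpanSingleton ℝ D⁻¹) hcont
    (hD.hasFDerivAt.hasFDerivWithinAt (s := Set.univ)) h1.hasFDerivAt.hasFDerivWithinAt ?_ ?_
    Set.self_mem_Ici
  · refine h3.hasDerivWithinAt.congr_deriv ?_
    simp only [ContinuousLinearMap.comp_apply, ContinuousLinearMap.toSpanSingleton_apply,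
      smul_eq_mul, one_mul]
    rw [← div_eq_mul_inv, div_eq_iff hpos.ne', h.genF_eq hyI.1 hyI.2.le, hDdef, kF]
    have := (h.wF_pos hyI.1 hyI.2.le).ne'
    have : r - y ≠ 0 := (sub_pos.2 hyI.2).ne'
    field_simp
    ring
  · filter_upwards [self_mem_nhdsWithin] with u hu using h.kF_flow (ht.trans hu) hs
  · intro z
    simp [hpos.ne']

lemma tendsto_exp_neg_alpha (h : HasTwoFixedPoints p q r) :
    Tendsto (fun t : ℝ => Real.exp (-alphaOf p q * t)) atTop (𝓝 0) :=
  Real.tendsto_exp_atBot.comp (tendsto_id.const_mul_atTop_of_neg (neg_lt_zero.2 h.alpha_pos))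

lemma tendsto_flow (h : HasTwoFixedPoints p q r) (hs : s ∈ Set.Ico 0 r) :
    Tendsto (fun t => flow p q r t s) atTop (𝓝 q) := by
  refine h.tendsto_of_tendsto_kF h.q_mem ?_ ?_
  · filter_upwards [eventually_ge_atTop 0] with t ht using h.flow_mem ht hs
  · have h1 := h.tendsto_exp_neg_alpha.mul_const (kF p q r s)
    rw [zero_mul, ← kF_q (p := p) (q := q) (r := r)] at h1
    refine h1.congr' ?_
    filter_upwards [eventually_ge_atTop 0] with t ht using (h.kF_flow ht hs).symm

/-- Second order expansion of the flow at its attracting fixed point. -/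
lemma flow_sub_isLittleO (h : HasTwoFixedPoints p q r) (hs : s ∈ Set.Ico 0 r) :
    (fun t => flow p q r t s - q - (kF p q r s * Real.exp (-alphaOf p q * t) -
      genDeriv₂ p q / (2 * alphaOf p q) * kF p q r s ^ 2 * Real.exp (-2 * alphaOf p q * t)))
      =o[atTop] fun t => Real.exp (-2 * alphaOf p q * t) := by
  set a := genDeriv₂ p q / (2 * alphaOf p q) with ha
  set y : ℝ → ℝ := fun t => flow p q r t s with hy
  set e : ℝ → ℝ := fun t => Real.exp (-alphaOf p q * t) with he
  have he2 : ∀ t, Real.exp (-2 * alphaOf p q * t) = e t * e t := fun t => by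
    rw [he, ← Real.exp_add]; ring_nf
  have hyq : Tendsto y atTop (𝓝 q) := h.tendsto_flow hs
  have hE : HasDerivAt (facE p q r) a q := by
    have h1 := h.hasDerivAt_facE h.q_nonneg h.lt
    rwa [h.facE_q, one_mul, h.gamma_div_sub_psi_q] at h1
  have hEinv : HasDerivAt (fun x => (facE p q r x)⁻¹) (-a) q := by
    have h1 := hE.inv (by rw [h.facE_q]; exact one_ne_zero)
    rwa [h.facE_q, one_pow, div_one] at h1
  -- `y - q` is of the order of `e`
  have hO : (fun t => y t - q) =O[atTop] e := by
    have h1 : Tendsto (fun t => kF p q r s * (facE p q r (y t))⁻¹) atTop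
        (𝓝 (kF p q r s * (facE p q r q)⁻¹)) :=
      ((hEinv.continuousAt.tendsto.comp hyq).const_mul _)
    have h2 := (h1.isBigO_one ℝ).mul (Asymptotics.isBigO_refl e atTop)
    simp only [one_mul] at h2
    refine h2.congr' ?_ EventuallyEq.rfl
    filter_upwards [eventually_ge_atTop 0] with t ht
    have h3 := h.kF_flow ht hs
    have h4 := (h.facE_pos (h.flow_mem ht hs).2).ne'
    rw [kF] at h3
    simp only [hy, he]
    field_simp
    rw [neg_mul] at h3
    linarith
  -- First-order Taylor expansion of `1/E` at `q`, transported along the flow; the error `o(y - q)`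
  -- is `o(e)` by `hO`.
  have hI : (fun t => (facE p q r (y t))⁻¹ - 1 + a * (y t - q)) =o[atTop] e := by
    have h1 := (hasDerivAt_iff_isLittleO.1 hEinv).comp_tendsto hyq
    refine (h1.congr_left fun t => ?_).trans_isBigO hO
    simp only [Function.comp, h.facE_q, smul_eq_mul, inv_one]
    ring
  have hE1 : (fun t => facE p q r (y t) - 1) =o[atTop] fun _ => (1 : ℝ) := by
    rw [Asymptotics.isLittleO_one_iff, ← sub_self (1 : ℝ)]
    have h1 := (hE.continuousAt.tendsto.comp hyq).sub_const 1
    rwa [h.facE_q] at h1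
  have hJ : (fun t => (y t - q) * (facE p q r (y t) - 1)) =o[atTop] e := by
    simpa using hO.mul_isLittleO hE1
  -- Since `y - q = K e / E(y)` and `(y - q) + (y - q)(E(y) - 1) = K e`, the remainder is exactly `K
  -- e` times the sum of the two `o(e)` terms.
  have hfin := (Asymptotics.isBigO_const_mul_self (kF p q r s) e atTop).mul_isLittleO
    (hI.add (hJ.const_mul_left a))
  refine hfin.congr' ?_ (Eventually.of_forall fun t => (he2 t).symm)
  filter_upwards [eventually_ge_atTop 0] with t ht
  have h3 : kF p q r s * e t = (y t - q) * facE p q r (y t) := by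
    rw [mul_comm]; exact (h.kF_flow ht hs).symm
  have h4 : facE p q r (y t) ≠ 0 := (h.facE_pos (h.flow_mem ht hs).2).ne'
  have h5 : kF p q r s * e t * (facE p q r (y t))⁻¹ = y t - q := by
    rw [h3, mul_inv_cancel_right₀ h4]
  rw [he2]
  linear_combination h5 - a * (kF p q r s * e t) * h3

end HasTwoFixedPoints

/-! ### Transition functions -/

lemma hasSum_option {f : Option ℕ → ℝ} {a : ℝ} (h : HasSum (fun j => f (some j)) a) :
    HasSum f (f none + a) := by
  have h1 : HasSum (fun x : Option ℕ => if x = none then f none else 0) (f none) :=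
    hasSum_ite_eq none (f none)
  have h2 : HasSum (fun x : Option ℕ => x.elim 0 fun j => f (some j)) a := by
    refine (Function.Injective.hasSum_iff (Option.some_injective ℕ) fun x hx => ?_).1 h
    cases x with
    | none => rfl
    | some j => exact absurd ⟨j, rfl⟩ hx
  refine (h1.add h2).congr_fun fun x => ?_
  cases x <;> simp

/-- The generator applied to `g`: a split moves `i` to `i - 1 + k`. The truncated subtraction at `i
= 0` is harmless because the rates vanish there. -/
lemma hasSum_rate_mul {p : ℕ → ℝ} {g : ℕ → ℝ} {i : ℕ} {S : ℝ}
    (h : HasSum (fun k => p k * g (i - 1 + k)) S) :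
    HasSum (fun j => rate p (some i) (some j) * g j) (i * (S - g i)) := by
  rcases Nat.eq_zero_or_pos i with rfl | hi
  · simp [rate]
  have h1 : HasSum (fun j => (if i ≤ j + 1 then p (j + 1 - i) else 0) * g j) S := by
    refine (Function.Injective.hasSum_iff (g := fun k => i - 1 + k) (add_right_injective _)
      fun j hj => ?_).1 (h.congr_fun fun k => ?_)
    · rw [if_neg, zero_mul]
      intro hij
      exact hj ⟨j + 1 - i, by simp only; omega⟩
    · simp only [Function.comp]
      rw [if_pos (by omega), show i - 1 + k + 1 - i = k by omega]
  have h2 : HasSum (fun j => if j = i then g i else 0) (g i) := hasSum_ite_eq i (g i)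
  refine ((h1.sub h2).mul_left (i : ℝ)).congr_fun fun j => ?_
  rw [rate]
  by_cases hij : i = j
  · subst hij; simp; ring
  · rw [if_neg hij, if_neg (Ne.symm hij)]; ring

lemma IsOffspringLaw.hasSum_rate {p : ℕ → ℝ} (hp : IsOffspringLaw p) (x : Option ℕ) :
    HasSum (rate p x) 0 := by
  cases x with
  | none => exact hasSum_zero
  | some i =>
    have h1 : HasSum (fun k => p k * 1) (∑' k, p k) := by
      simpa only [mul_one] using hp.summable.hasSum
    have h2 := hasSum_rate_mul (g := fun _ => 1) (i := i) h1
    simp only [mul_one] at h2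
    have h3 := hasSum_option (f := rate p (some i)) h2
    convert h3 using 1
    simp only [rate]
    ring

/-- The expectation of `g` at time `t` for the process started from `i`, over the states that
are not the graveyard. -/
noncomputable def expect (P : ℝ≥0 → Option ℕ → Option ℕ → ℝ) (g : ℕ → ℝ) (t : ℝ≥0) (i : ℕ) : ℝ :=
  ∑' j, P t (some i) (some j) * g j

namespace IsTransitionFunction

variable {p : ℕ → ℝ} {P : ℝ≥0 → Option ℕ → Option ℕ → ℝ}

lemma le_one (hP : IsTransitionFunction p P) (t : ℝ≥0) (x y : Option ℕ) : P t x y ≤ 1 :=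
  le_hasSum (hP.hasSum_one t x) y fun z _ => hP.nonneg t x z

lemma tendsto_self (hP : IsTransitionFunction p P) (x : Option ℕ) :
    Tendsto (fun h => P h x x) (𝓝 0) (𝓝 1) := by
  have h1 := (hP.rates x x).mul (tendsto_nhdsWithin_of_tendsto_nhds
    (s := Set.Ioi 0) (NNReal.continuous_coe.tendsto (0 : ℝ≥0)))
  simp only [hP.zero, if_true, NNReal.coe_zero, mul_zero] at h1
  have h2 : Tendsto (fun h => P h x x) (𝓝[>] 0) (𝓝 1) := by
    have h3 := h1.add_const 1
    rw [zero_add] at h3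
    refine h3.congr' ?_
    filter_upwards [self_mem_nhdsWithin] with h hh
    have : (h : ℝ) ≠ 0 := NNReal.coe_ne_zero.2 (ne_of_gt hh)
    field_simp
    ring
  have h4 : 𝓝 (0 : ℝ≥0) = 𝓝[>] 0 ⊔ pure 0 := by
    have h5 : (Set.Ici (0 : ℝ≥0)) = Set.univ := by ext z; simp
    rw [← nhdsWithin_univ, ← h5, ← Set.Ioi_insert, nhdsWithin_insert, sup_comm]
  rw [h4]
  refine h2.sup ?_
  rw [tendsto_pure_left]
  intro s hs
  rw [hP.zero, if_pos rfl]
  exact mem_of_mem_nhds hs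

lemma mul_self_le (hP : IsTransitionFunction p P) (s t : ℝ≥0) (x : Option ℕ) :
    P s x x * P t x x ≤ P (s + t) x x :=
  le_hasSum (hP.chapman_kolmogorov s t x x) x fun _ _ => mul_nonneg (hP.nonneg _ _ _)
    (hP.nonneg _ _ _)

/-- The escape probability is subadditive, `1 - P (n h) ≤ n * (1 - P h)`. With `n h = t` the right
side is `t` times a difference quotient whose limit is zero. -/
lemma eq_one_of_rate_eq_zero (hP : IsTransitionFunction p P) {x : Option ℕ} (hx : rate p x x = 0)
    (t : ℝ≥0) : P t x x = 1 := by
  rcases eq_or_ne t 0 with rfl | ht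
  · rw [hP.zero, if_pos rfl]
  have hmul : ∀ (h : ℝ≥0) (n : ℕ), 1 - P (n * h) x x ≤ n * (1 - P h x x) := fun h n => by
    induction n with
    | zero => simp [hP.zero]
    | succ n ih =>
      have h1 := hP.mul_self_le (n * h) h x
      have h2 := hP.le_one (n * h) x x
      have h3 := hP.le_one h x x
      have h4 := hP.nonneg (n * h) x x
      push_cast
      rw [add_mul (n : ℝ≥0) 1 h, one_mul]
      nlinarith
  have hlim := hP.rates x x
  rw [hx] at hlim
  simp only [hP.zero, if_true] at hlim
  have hseq : Tendsto (fun n : ℕ => t / ((n : ℝ≥0) + 1)) atTop (𝓝[>] 0) := by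
    refine tendsto_nhdsWithin_iff.2 ⟨?_, Eventually.of_forall fun n => ?_⟩
    · rw [← NNReal.tendsto_coe]
      have := (tendsto_one_div_add_atTop_nhds_zero_nat (𝕜 := ℝ)).const_mul (t : ℝ)
      rw [mul_zero] at this
      refine this.congr fun n => ?_
      push_cast
      ring
    · have : 0 < t := pos_iff_ne_zero.2 ht
      simp only [Set.mem_Ioi]
      positivity
  have h5 := (hlim.comp hseq).mul_const (t : ℝ)
  rw [zero_mul] at h5
  refine le_antisymm (hP.le_one t x x) ?_
  have h7 : (0 : ℝ) + 1 ≤ P t x x := by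
    refine le_of_tendsto' (h5.add_const 1) fun n => ?_
    have h6 := hmul (t / ((n : ℝ≥0) + 1)) (n + 1)
    have hn : ((n : ℝ≥0) + 1) ≠ 0 := by positivity
    have htr : (t : ℝ) ≠ 0 := NNReal.coe_ne_zero.2 ht
    push_cast at h6
    rw [mul_div_cancel₀ _ hn] at h6
    simp only [Function.comp]
    push_cast
    have hn' : ((n : ℝ) + 1) ≠ 0 := by positivity
    field_simp
    linarith
  linarith

lemma eq_zero_of_rate_eq_zero (hP : IsTransitionFunction p P) {x y : Option ℕ}
    (hx : rate p x x = 0) (hxy : y ≠ x) (t : ℝ≥0) : P t x y = 0 := by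
  have h1 := sum_le_hasSum {x, y} (fun z _ => hP.nonneg t x z) (hP.hasSum_one t x)
  rw [Finset.sum_pair hxy.symm, hP.eq_one_of_rate_eq_zero hx] at h1
  exact le_antisymm (by linarith) (hP.nonneg t x y)

lemma rate_none : rate p none none = 0 := rfl

lemma rate_some_zero : rate p (some 0) (some 0) = 0 := by simp [rate]

/-- The lower bound for the generator applied to a nonnegative function. -/
lemma lt_slope (hP : IsTransitionFunction p P) {g : Option ℕ → ℝ} (hg : ∀ y, 0 ≤ g y)
    {x : Option ℕ} (hsum : ∀ h, Summable fun y => P h x y * g y) {S c : ℝ}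
    (hS : HasSum (fun y => rate p x y * g y) S) (hc : c < S) :
    ∀ᶠ h : ℝ≥0 in 𝓝[>] 0, g x + c * h < ∑' y, P h x y * g y := by
  -- A Fatou argument: finitely many states already give a slope above `c`, and nonnegativity
  -- discards the rest. The set contains `x` so that at time `0` it carries the value `g x`.
  obtain ⟨A, hAc, hxA⟩ : ∃ A : Finset (Option ℕ), c < ∑ y ∈ A, rate p x y * g y ∧ x ∈ A :=
    ((hS.eventually (lt_mem_nhds hc)).and
      ((eventually_ge_atTop {x}).mono fun A hA => Finset.singleton_subset_iff.1 hA)).exists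
  have hlim : Tendsto (fun h : ℝ≥0 => ∑ y ∈ A, (P h x y - P 0 x y) / (h : ℝ) * g y) (𝓝[>] 0)
      (𝓝 (∑ y ∈ A, rate p x y * g y)) :=
    tendsto_finsetSum _ fun y _ => (hP.rates x y).mul_const _
  filter_upwards [hlim.eventually (lt_mem_nhds hAc), self_mem_nhdsWithin] with h hh hpos
  have hpos' : 0 < (h : ℝ) := NNReal.coe_pos.2 hpos
  have h1 : ∑ y ∈ A, P 0 x y * g y = g x := by
    rw [Finset.sum_eq_single_of_mem x hxA]
    · simp [hP.zero]
    · intro y _ hy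
      simp [hP.zero, hy.symm]
  have h2 : ∑ y ∈ A, (P h x y - P 0 x y) / (h : ℝ) * g y =
      (∑ y ∈ A, P h x y * g y - g x) / h := by
    rw [← h1, ← Finset.sum_sub_distrib, Finset.sum_div]
    exact Finset.sum_congr rfl fun y _ => by ring
  rw [h2, lt_div_iff₀ hpos'] at hh
  have h3 := (hsum h).sum_le_tsum A fun y _ => mul_nonneg (hP.nonneg h x y) (hg y)
  linarith

/-- The upper bound for the generator applied to a bounded function. -/
lemma slope_lt (hP : IsTransitionFunction p P) (hp : IsOffspringLaw p) {g : Option ℕ → ℝ}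
    {C : ℝ} (hg : ∀ y, g y ≤ C)
    {x : Option ℕ} (hsum : ∀ h, Summable fun y => P h x y * g y) {S c : ℝ}
    (hS : HasSum (fun y => rate p x y * g y) S) (hc : S < c) :
    ∀ᶠ h : ℝ≥0 in 𝓝[>] 0, ∑' y, P h x y * g y < g x + c * h := by
  -- Reflection `g ↦ C - g` reduces to the lower bound; constants drop out because the rows of `P`
  -- sum to one and those of `rate` to zero.
  have hC : ∀ h, HasSum (fun y => P h x y * (C - g y)) (C - ∑' y, P h x y * g y) := fun h => by
    have h1 := ((hP.hasSum_one h x).mul_right C).sub (hsum h).hasSum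
    rw [one_mul] at h1
    exact h1.congr_fun fun y => by ring
  have hS' : HasSum (fun y => rate p x y * (C - g y)) (-S) := by
    have h1 := ((hp.hasSum_rate x).mul_right C).sub hS
    rw [zero_mul, zero_sub] at h1
    exact h1.congr_fun fun y => by ring
  filter_upwards [hP.lt_slope (fun y => sub_nonneg.2 (hg y)) (fun h => (hC h).summable) hS'
    (neg_lt_neg hc)] with h hh
  rw [(hC h).tsum_eq] at hh
  linarith

lemma hasSum_elim (g : ℕ → ℝ) (t : ℝ≥0) (i : ℕ)
    (hs : Summable fun j => P t (some i) (some j) * g j) :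
    HasSum (fun y : Option ℕ => P t (some i) y * y.elim 0 g) (expect P g t i) := by
  have h1 := hasSum_option (f := fun y : Option ℕ => P t (some i) y * y.elim 0 g) hs.hasSum
  simpa [expect] using h1

lemma lt_slope_expect (hP : IsTransitionFunction p P) {g : ℕ → ℝ} (hg : ∀ j, 0 ≤ g j) {i : ℕ}
    (hsum : ∀ h, Summable fun j => P h (some i) (some j) * g j) {S c : ℝ}
    (hS : HasSum (fun k => p k * g (i - 1 + k)) S) (hc : c < i * (S - g i)) :
    ∀ᶠ h : ℝ≥0 in 𝓝[>] 0, g i + c * h < expect P g h i := by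
  have hS' := hasSum_option (f := fun y : Option ℕ => rate p (some i) y * y.elim 0 g)
    (hasSum_rate_mul hS)
  simp only [Option.elim_none, mul_zero, zero_add] at hS'
  filter_upwards [hP.lt_slope (g := fun y => y.elim 0 g) (fun y => by cases y <;> simp [hg])
    (fun h => (hasSum_elim g h i (hsum h)).summable) hS' hc] with h hh
  rwa [(hasSum_elim g h i (hsum h)).tsum_eq] at hh

lemma expect_slope_lt (hP : IsTransitionFunction p P) (hp : IsOffspringLaw p) {g : ℕ → ℝ} {C : ℝ}
    (hC : 0 ≤ C) (hgC : ∀ j, g j ≤ C) {i : ℕ}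
    (hsum : ∀ h, Summable fun j => P h (some i) (some j) * g j) {S c : ℝ}
    (hS : HasSum (fun k => p k * g (i - 1 + k)) S) (hc : i * (S - g i) < c) :
    ∀ᶠ h : ℝ≥0 in 𝓝[>] 0, expect P g h i < g i + c * h := by
  have hS' := hasSum_option (f := fun y : Option ℕ => rate p (some i) y * y.elim 0 g)
    (hasSum_rate_mul hS)
  simp only [Option.elim_none, mul_zero, zero_add] at hS'
  filter_upwards [hP.slope_lt hp (g := fun y => y.elim 0 g) (C := C)
    (fun y => by cases y <;> simp [hgC, hC])
    (fun h => (hasSum_elim g h i (hsum h)).summable) hS' hc] with h hh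
  rwa [(hasSum_elim g h i (hsum h)).tsum_eq] at hh

lemma chapman_kolmogorov_some (hP : IsTransitionFunction p P) (s t : ℝ≥0) (i k : ℕ) :
    HasSum (fun j => P s (some i) (some j) * P t (some j) (some k)) (P (s + t) (some i) (some k)) := by
  refine (Function.Injective.hasSum_iff (f := fun y => P s (some i) y * P t y (some k))
    (Option.some_injective ℕ) fun x hx => ?_).2
    (hP.chapman_kolmogorov s t (some i) (some k))
  cases x with
  | none => rw [hP.eq_zero_of_rate_eq_zero rate_none (by simp), mul_zero]
  | some j => exact absurd ⟨j, rfl⟩ hx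

lemma hasSum_expect_add (hP : IsTransitionFunction p P) {g : ℕ → ℝ} (hg : ∀ j, 0 ≤ g j)
    (hsum : ∀ t i, Summable fun j => P t (some i) (some j) * g j) (s t : ℝ≥0) (i : ℕ) :
    HasSum (fun j => P s (some i) (some j) * expect P g t j) (expect P g (s + t) i) := by
  set F : ℕ × ℕ → ℝ := fun z => P s (some i) (some z.2) * P t (some z.2) (some z.1) * g z.1 with hF
  have hF0 : ∀ z, 0 ≤ F z := fun z =>
    mul_nonneg (mul_nonneg (hP.nonneg _ _ _) (hP.nonneg _ _ _)) (hg _)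
  have hfib : ∀ k, HasSum (fun j => F (k, j)) (P (s + t) (some i) (some k) * g k) := fun k =>
    (hP.chapman_kolmogorov_some s t i k).mul_right _
  have hFs : Summable F := by
    refine (summable_prod_of_nonneg hF0).2 ⟨fun k => (hfib k).summable, ?_⟩
    exact (hsum (s + t) i).congr fun k => (hfib k).tsum_eq.symm
  have htot : HasSum F (expect P g (s + t) i) := by
    have h1 := hFs.hasSum
    rwa [hFs.tsum_prod' fun k => (hfib k).summable, tsum_congr fun k => (hfib k).tsum_eq] at h1
  have hswap : HasSum (fun z : ℕ × ℕ => F z.swap) (expect P g (s + t) i) :=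
    (Equiv.prodComm ℕ ℕ).hasSum_iff.2 htot
  refine hswap.prod_fiberwise fun j => ?_
  refine ((hsum t j).hasSum.mul_left (P s (some i) (some j))).congr_fun fun k => ?_
  simp only [hF, Prod.swap]
  ring

lemma expect_nonneg (hP : IsTransitionFunction p P) {g : ℕ → ℝ} (hg : ∀ j, 0 ≤ g j) (t : ℝ≥0)
    (i : ℕ) : 0 ≤ expect P g t i :=
  tsum_nonneg fun j => mul_nonneg (hP.nonneg _ _ _) (hg j)

lemma expect_zero (hP : IsTransitionFunction p P) (g : ℕ → ℝ) (i : ℕ) : expect P g 0 i = g i := by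
  rw [expect, tsum_eq_single i]
  · simp [hP.zero]
  · intro j hj
    simp [hP.zero, hj.symm]

lemma summable_some (hP : IsTransitionFunction p P) (t : ℝ≥0) (x : Option ℕ) :
    Summable fun j => P t x (some j) :=
  (hP.hasSum_one t x).summable.comp_injective (Option.some_injective ℕ)

lemma summable_of_le (hP : IsTransitionFunction p P) {g : ℕ → ℝ} {C : ℝ} (hg : ∀ j, 0 ≤ g j)
    (hgC : ∀ j, g j ≤ C) (t : ℝ≥0) (i : ℕ) :
    Summable fun j => P t (some i) (some j) * g j :=
  Summable.of_nonneg_of_le (fun j => mul_nonneg (hP.nonneg _ _ _) (hg j))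
    (fun j => mul_le_mul_of_nonneg_left (hgC j) (hP.nonneg _ _ _))
    ((hP.summable_some t (some i)).mul_right C)

lemma tsum_some_le_one (hP : IsTransitionFunction p P) (t : ℝ≥0) (x : Option ℕ) :
    ∑' j, P t x (some j) ≤ 1 := by
  have h1 := hasSum_option (hP.summable_some t x).hasSum
  have h2 := h1.unique (hP.hasSum_one t x)
  linarith [hP.nonneg t x none]

lemma expect_le (hP : IsTransitionFunction p P) {g : ℕ → ℝ} {C : ℝ} (hg : ∀ j, 0 ≤ g j)
    (hgC : ∀ j, g j ≤ C) (t : ℝ≥0) (i : ℕ) : expect P g t i ≤ C := by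
  calc expect P g t i ≤ ∑' j, P t (some i) (some j) * C :=
        (hP.summable_of_le hg hgC t i).tsum_le_tsum
          (fun j => mul_le_mul_of_nonneg_left (hgC j) (hP.nonneg _ _ _))
          ((hP.summable_some t (some i)).mul_right C)
    _ ≤ C := by
        rw [tsum_mul_right]
        exact mul_le_of_le_one_left ((hg 0).trans (hgC 0)) (hP.tsum_some_le_one t _)

/-- Split off the first time span `h`: with probability `P h i i` the process is at `i` again, and
otherwise the value lies in `[0, C]`. The two halves keep the `j = i` term for `expect` and for `C -
expect`. The bound does not depend on `t`. -/
lemma abs_expect_add_sub_le (hP : IsTransitionFunction p P) {g : ℕ → ℝ} {C : ℝ}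
    (hg : ∀ j, 0 ≤ g j) (hgC : ∀ j, g j ≤ C) (t h : ℝ≥0) (i : ℕ) :
    |expect P g (t + h) i - expect P g t i| ≤ C * (1 - P h (some i) (some i)) := by
  have h1 := hP.hasSum_expect_add hg (hP.summable_of_le hg hgC) h t i
  rw [add_comm h t] at h1
  have hu0 := hP.expect_nonneg hg t
  have huC := hP.expect_le hg hgC t
  have hC : 0 ≤ C := (hg 0).trans (hgC 0)
  have hp1 := hP.le_one h (some i) (some i)
  rw [abs_le]
  constructor
  · have h2 := le_hasSum h1 i fun j _ => mul_nonneg (hP.nonneg _ _ _) (hu0 j)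
    nlinarith [huC i, mul_le_mul_of_nonneg_right (huC i) (sub_nonneg.2 hp1)]
  · have h3 : HasSum (fun j => P h (some i) (some j) * (C - expect P g t j))
        ((∑' j, P h (some i) (some j)) * C - expect P g (t + h) i) :=
      (((hP.summable_some h (some i)).hasSum.mul_right C).sub h1).congr_fun fun j => by ring
    have h4 := le_hasSum h3 i fun j _ => mul_nonneg (hP.nonneg _ _ _) (sub_nonneg.2 (huC j))
    have h5 := mul_le_mul_of_nonneg_right (hP.tsum_some_le_one h (some i)) hC
    nlinarith [hu0 i, mul_nonneg (sub_nonneg.2 hp1) (hu0 i)]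

lemma continuous_expect (hP : IsTransitionFunction p P) {g : ℕ → ℝ} {C : ℝ}
    (hg : ∀ j, 0 ≤ g j) (hgC : ∀ j, g j ≤ C) (i : ℕ) :
    Continuous fun t => expect P g t i := by
  refine continuous_iff_continuousAt.2 fun t => tendsto_iff_dist_tendsto_zero.2 ?_
  have hb : Tendsto (fun s : ℝ≥0 => C * (1 - P (nndist s t) (some i) (some i))) (𝓝 t) (𝓝 0) := by
    have h1 : Tendsto (fun s : ℝ≥0 => nndist s t) (𝓝 t) (𝓝 0) := by
      have : Continuous fun s : ℝ≥0 => nndist s t := by fun_prop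
      simpa using this.tendsto t
    have h2 := (((hP.tendsto_self (some i)).comp h1).const_sub 1).const_mul C
    simpa using h2
  refine squeeze_zero (fun s => dist_nonneg) (fun s => ?_) hb
  rw [Real.dist_eq]
  rcases le_total s t with hst | hst
  · obtain ⟨h, rfl⟩ := exists_add_of_le hst
    rw [abs_sub_comm]
    have : nndist s (s + h) = h := by
      rw [← NNReal.coe_inj, coe_nndist, NNReal.dist_eq]; simp
    rw [this]
    exact hP.abs_expect_add_sub_le hg hgC s h i
  · obtain ⟨h, rfl⟩ := exists_add_of_le hst
    have : nndist (t + h) t = h := by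
      rw [← NNReal.coe_inj, coe_nndist, NNReal.dist_eq]; simp
    rw [this]
    exact hP.abs_expect_add_sub_le hg hgC t h i

lemma continuous_apply (hP : IsTransitionFunction p P) (i j : ℕ) :
    Continuous fun t => P t (some i) (some j) := by
  have h1 := hP.continuous_expect (g := fun k => if k = j then 1 else 0) (C := 1)
    (fun k => by split_ifs <;> simp) (fun k => by split_ifs <;> simp) i
  refine h1.congr fun t => ?_
  simp [expect]

end IsTransitionFunction

/-! ### Comparison with solutions of the backward equation -/

/-- A comparison principle on `ℝ≥0`: two families of continuous functions, ordered at time `0` and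
far away, remain ordered if at each touching point they are separated by a common slope. -/
theorem le_of_touching {U B : ℝ≥0 → ℕ → ℝ} (hU : ∀ i, Continuous fun t => U t i)
    (hB : ∀ i, Continuous fun t => B t i) (h0 : ∀ i, U 0 i ≤ B 0 i)
    (hfar : ∀ τ : ℝ≥0, ∃ N, ∀ i, N ≤ i → ∀ t ≤ τ, U t i ≤ B t i)
    (htouch : ∀ t i, U t i = B t i → (∀ j, U t j ≤ B t j) → ∃ c : ℝ,
      (∀ᶠ h : ℝ≥0 in 𝓝[>] 0, U (t + h) i ≤ U t i + c * h) ∧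
      ∀ᶠ h : ℝ≥0 in 𝓝[>] 0, B t i + c * h ≤ B (t + h) i) (t : ℝ≥0) (i : ℕ) :
    U t i ≤ B t i := by
  set S : Set ℝ≥0 := {s | ∀ j, U s j ≤ B s j} with hS
  have hclosed : IsClosed S := by
    rw [hS, Set.ofPred_forall]
    exact isClosed_iInter fun j => isClosed_le (hU j) (hB j)
  have hsub : Set.Icc 0 t ⊆ S := by
    -- Continuous induction in time: the set of ordered times is closed, and the order persists for
    -- a short while after each of its points.
    refine IsClosed.Icc_subset_of_forall_exists_gt (hclosed.inter isClosed_Icc) h0 ?_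
    rintro s ⟨hsS, hst⟩ y hy
    obtain ⟨N, hN⟩ := hfar t
    have hloc : ∀ j, ∀ᶠ h : ℝ≥0 in 𝓝[>] 0, U (s + h) j ≤ B (s + h) j := fun j => by
      rcases (hsS j).lt_or_eq with hlt | heq
      · have hcont : Continuous fun h : ℝ≥0 => B (s + h) j - U (s + h) j :=
          ((hB j).comp (continuous_const.add continuous_id)).sub
            ((hU j).comp (continuous_const.add continuous_id))
        have h1 := hcont.tendsto 0
        rw [add_zero] at h1
        filter_upwards [nhdsWithin_le_nhds (h1.eventually (lt_mem_nhds (sub_pos.2 hlt)))] with h hh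
        exact (sub_pos.1 hh).le
      · obtain ⟨c, hc1, hc2⟩ := htouch s j heq hsS
        filter_upwards [hc1, hc2] with h hh1 hh2
        rw [heq] at hh1
        exact hh1.trans hh2
    -- The admissible step depends on `j`, but only finitely many `j` matter; the others are covered
    -- by `hfar` as long as `s + h ≤ t`.
    have hfin : ∀ᶠ h : ℝ≥0 in 𝓝[>] 0, ∀ j ∈ Finset.range N, U (s + h) j ≤ B (s + h) j :=
      (Finset.eventually_all _).2 fun j _ => hloc j
    have hsmall : ∀ᶠ h : ℝ≥0 in 𝓝[>] 0, h < min (y - s) (t - s) :=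
      nhdsWithin_le_nhds (gt_mem_nhds (lt_min (tsub_pos_of_lt hy) (tsub_pos_of_lt hst.2)))
    obtain ⟨h, ⟨hh1, hh2⟩, hh3⟩ := ((hfin.and hsmall).and self_mem_nhdsWithin).exists
    have hh3' : 0 < h := hh3
    refine ⟨s + h, fun j => ?_, lt_add_of_pos_right s hh3', ?_⟩
    · rcases lt_or_ge j N with hj | hj
      · exact hh1 j (Finset.mem_range.2 hj)
      · refine hN j hj _ ?_
        have := (hh2.trans_le (min_le_right _ _)).le
        exact (add_le_add_right this s).trans (add_tsub_cancel_of_le hst.2.le).le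
    · have := (hh2.trans_le (min_le_left _ _)).le
      exact (add_le_add_right this s).trans (add_tsub_cancel_of_le (le_of_lt hy)).le
  exact hsub (Set.right_mem_Icc.2 zero_le) i

/-- Right differentiability, along nonnegative increments. -/
lemma tendsto_slope_nnreal {F : ℝ → ℝ} {F' : ℝ} {t : ℝ≥0}
    (hF : HasDerivWithinAt F F' (Set.Ici (t : ℝ)) t) :
    Tendsto (fun h : ℝ≥0 => (F ((t + h : ℝ≥0) : ℝ) - F t) / h) (𝓝[>] 0) (𝓝 F') := by
  have h1 := hasDerivWithinAt_iff_tendsto_slope.1 hF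
  rw [Set.Ici_sdiff_left] at h1
  have h2 : Tendsto (fun h : ℝ≥0 => ((t + h : ℝ≥0) : ℝ)) (𝓝[>] 0) (𝓝[>] (t : ℝ)) := by
    refine tendsto_nhdsWithin_iff.2 ⟨?_, ?_⟩
    · have : Continuous fun h : ℝ≥0 => ((t + h : ℝ≥0) : ℝ) := by fun_prop
      simpa using (this.tendsto 0).mono_left nhdsWithin_le_nhds
    · filter_upwards [self_mem_nhdsWithin] with h hh
      have : (0 : ℝ) < h := NNReal.coe_pos.2 hh
      simpa using this
  refine (h1.comp h2).congr fun h => ?_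
  simp [slope_def_field]

lemma eventually_le_of_hasDerivWithinAt {F : ℝ → ℝ} {F' c : ℝ} {t : ℝ≥0}
    (hF : HasDerivWithinAt F F' (Set.Ici (t : ℝ)) t) (hc : F' < c) :
    ∀ᶠ h : ℝ≥0 in 𝓝[>] 0, F ((t + h : ℝ≥0) : ℝ) ≤ F t + c * h := by
  filter_upwards [(tendsto_slope_nnreal hF).eventually (gt_mem_nhds hc), self_mem_nhdsWithin]
    with h hh hpos
  rw [div_lt_iff₀ (NNReal.coe_pos.2 hpos)] at hh
  linarith

lemma eventually_ge_of_hasDerivWithinAt {F : ℝ → ℝ} {F' c : ℝ} {t : ℝ≥0}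
    (hF : HasDerivWithinAt F F' (Set.Ici (t : ℝ)) t) (hc : c < F') :
    ∀ᶠ h : ℝ≥0 in 𝓝[>] 0, F t + c * h ≤ F ((t + h : ℝ≥0) : ℝ) := by
  filter_upwards [(tendsto_slope_nnreal hF).eventually (lt_mem_nhds hc), self_mem_nhdsWithin]
    with h hh hpos
  rw [lt_div_iff₀ (NNReal.coe_pos.2 hpos)] at hh
  linarith

/-! ### The generating function of the process is the flow. -/

namespace HasTwoFixedPoints

variable {p : ℕ → ℝ} {q r s : ℝ} {P : ℝ≥0 → Option ℕ → Option ℕ → ℝ}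

lemma continuous_flow_pow (h : HasTwoFixedPoints p q r) (hs : s ∈ Set.Ico 0 r) (i : ℕ) :
    Continuous fun t : ℝ≥0 => flow p q r t s ^ i :=
  ((h.continuousOn_flow hs).comp_continuous NNReal.continuous_coe fun t => t.2).pow i

/-- The derivative is the generator applied to `j ↦ φ ^ j` at `i`, so powers of the flow solve the
backward equation. -/
lemma hasDerivWithinAt_flow_pow (h : HasTwoFixedPoints p q r) (hs : s ∈ Set.Ico 0 r) (t : ℝ≥0)
    (i : ℕ) : HasDerivWithinAt (fun u => flow p q r u s ^ i)
      (i * (flow p q r t s ^ (i - 1) * genF p (flow p q r t s) - flow p q r t s ^ i))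
      (Set.Ici (t : ℝ)) t := by
  refine ((h.hasDerivWithinAt_flow hs t.2).fun_pow i).congr_deriv ?_
  rcases Nat.eq_zero_or_pos i with rfl | hi
  · simp
  · conv_rhs => rw [← Nat.sub_add_cancel hi, pow_succ]
    rw [Nat.sub_add_cancel hi, NNReal.val_eq_coe]
    ring

lemma hasSum_flow_pow (h : HasTwoFixedPoints p q r) (hs : s ∈ Set.Ico 0 r) (t : ℝ≥0) (i : ℕ) :
    HasSum (fun k => p k * flow p q r t s ^ (i - 1 + k))
      (flow p q r t s ^ (i - 1) * genF p (flow p q r t s)) := by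
  have hm := h.flow_mem t.2 hs
  refine ((h.hasSum_genF hm.1 hm.2.le).mul_left (flow p q r t s ^ (i - 1))).congr_fun fun k => ?_
  rw [NNReal.val_eq_coe, pow_add]
  ring

/-- Truncated powers are dominated by powers of the flow. -/
lemma expect_min_le_flow_pow (h : HasTwoFixedPoints p q r) (hr : 1 ≤ r) (hp : IsOffspringLaw p)
    (hP : IsTransitionFunction p P) (hs : s ∈ Set.Ico 0 r) {M : ℝ} (hM : 0 ≤ M) (t : ℝ≥0) (i : ℕ) :
    expect P (fun j => min (s ^ j) M) t i ≤ flow p q r t s ^ i := by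
  set g : ℕ → ℝ := fun j => min (s ^ j) M with hg
  have hg0 : ∀ j, 0 ≤ g j := fun j => le_min (pow_nonneg hs.1 j) hM
  have hgM : ∀ j, g j ≤ M := fun j => min_le_right _ _
  set m := genDeriv p 1 with hm
  have hmsum := h.hasSum_genDeriv zero_le_one hr
  have hm0 : 0 ≤ m := hmsum.nonneg fun k =>
    mul_nonneg (mul_nonneg (by positivity) (h.nonneg _)) (by simp)
  have hm1 : HasSum (fun k : ℕ => p k * k) m := by
    refine (hasSum_nat_add_iff' 1).1 ?_
    simp only [Finset.range_one, Finset.sum_singleton, Nat.cast_zero, mul_zero, sub_zero]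
    refine hmsum.congr_fun fun k => ?_
    push_cast
    rw [one_pow]
    ring
  -- The generator maps `i + 1` to at most `i * (m - 1)`, with `m = f' 1`, which is below `(m + 1) *
  -- (i + 1)`. So the added term is a strict supersolution, and for large `i` it exceeds the
  -- truncation level `M`.
  suffices hε : ∀ ε : ℝ, 0 < ε → expect P g t i ≤
      ε * Real.exp ((m + 1) * t) * (i + 1) + flow p q r t s ^ i by
    refine le_of_forall_pos_le_add fun ε hε' => ?_
    have hpos : 0 < Real.exp ((m + 1) * t) * ((i : ℝ) + 1) := by positivity
    have h1 := hε (ε / (Real.exp ((m + 1) * t) * ((i : ℝ) + 1))) (div_pos hε' hpos)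
    rw [mul_assoc, div_mul_cancel₀ _ hpos.ne'] at h1
    linarith
  intro ε hε
  refine le_of_touching (U := fun t i => expect P g t i)
    (B := fun t i => ε * Real.exp ((m + 1) * t) * (i + 1) + flow p q r t s ^ i)
    (fun i => hP.continuous_expect hg0 hgM i) (fun i => ?_) (fun i => ?_) (fun τ => ?_)
    (fun t i heq hle => ?_) t i
  · exact (by fun_prop : Continuous fun t : ℝ≥0 => ε * Real.exp ((m + 1) * t) * ((i : ℝ) + 1)).add
      (h.continuous_flow_pow hs i)
  · simp only [hP.expect_zero, NNReal.coe_zero, h.flow_zero hs]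
    have : 0 ≤ ε * Real.exp ((m + 1) * 0) * ((i : ℝ) + 1) := by positivity
    linarith [min_le_left (s ^ i) M]
  · obtain ⟨N, hN⟩ := exists_nat_ge (M / ε)
    refine ⟨N, fun i hi t _ => (hP.expect_le hg0 hgM t i).trans ?_⟩
    have h1 : M ≤ ε * ((i : ℝ) + 1) := by
      rw [div_le_iff₀ hε] at hN
      have : (N : ℝ) ≤ i := Nat.cast_le.2 hi
      nlinarith
    have h2 : 1 ≤ Real.exp ((m + 1) * t) := by
      rw [Real.one_le_exp_iff]; positivity
    have h3 : 0 ≤ flow p q r t s ^ i := pow_nonneg (h.flow_mem t.2 hs).1 i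
    have h4 : ε * ((i : ℝ) + 1) ≤ ε * Real.exp ((m + 1) * t) * ((i : ℝ) + 1) := by
      have : 0 ≤ ε * ((i : ℝ) + 1) := by positivity
      nlinarith
    linarith
  · set e := ε * Real.exp ((m + 1) * t) with he
    have he0 : 0 < e := by positivity
    set φ := flow p q r t s with hφ
    have hBD : HasDerivWithinAt
        (fun u : ℝ => ε * Real.exp ((m + 1) * u) * ((i : ℝ) + 1) + flow p q r u s ^ i)
        ((m + 1) * e * ((i : ℝ) + 1) + i * (φ ^ (i - 1) * genF p φ - φ ^ i))
        (Set.Ici (t : ℝ)) t := by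
      have h1 : HasDerivAt (fun u : ℝ => ε * Real.exp ((m + 1) * u) * ((i : ℝ) + 1))
          ((m + 1) * e * ((i : ℝ) + 1)) (t : ℝ) := by
        refine (((((hasDerivAt_id (t : ℝ)).const_mul (m + 1)).exp).const_mul ε).mul_const
          ((i : ℝ) + 1)).congr_deriv ?_
        simp only [id, he]
        ring
      exact h1.hasDerivWithinAt.add (h.hasDerivWithinAt_flow_pow hs t i)
    have hu0 := hP.expect_nonneg hg0 t
    have hSB : HasSum (fun k => p k * (e * ((i - 1 + k : ℕ) + 1) + φ ^ (i - 1 + k)))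
        (e * (((i - 1 : ℕ) + 1) * ∑' k, p k + m) + φ ^ (i - 1) * genF p φ) := by
      have h1 := ((hp.summable.hasSum.mul_left (((i - 1 : ℕ) : ℝ) + 1)).add hm1).mul_left e
      refine (h1.add (h.hasSum_flow_pow hs t i)).congr_fun fun k => ?_
      push_cast
      ring
    have hSu : Summable fun k => p k * expect P g t (i - 1 + k) :=
      Summable.of_nonneg_of_le (fun k => mul_nonneg (h.nonneg k) (hu0 _))
        (fun k => mul_le_mul_of_nonneg_left (hle _) (h.nonneg k)) hSB.summable
    have hle' := hasSum_le (fun k => mul_le_mul_of_nonneg_left (hle (i - 1 + k)) (h.nonneg k))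
      hSu.hasSum hSB
    have hlt : i * ((∑' k, p k * expect P g t (i - 1 + k)) - expect P g t i) <
        (m + 1) * e * ((i : ℝ) + 1) + i * (φ ^ (i - 1) * genF p φ - φ ^ i) := by
      rw [heq]
      rcases Nat.eq_zero_or_pos i with rfl | hi
      · simp only [Nat.cast_zero, zero_mul, add_zero]
        positivity
      · have hi1 : ((i - 1 : ℕ) : ℝ) + 1 = i := by
          exact_mod_cast Nat.sub_add_cancel hi
        rw [hi1] at hle'
        have hi0 : (0 : ℝ) < i := Nat.cast_pos.2 hi
        have h1 := mul_le_mul_of_nonneg_left hle' hi0.le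
        have h2 : (i : ℝ) * ∑' k, p k ≤ i := mul_le_of_le_one_right hi0.le hp.tsum_le_one
        have h3 : e * (i * ∑' k, p k + m) ≤ e * (i + m) := by gcongr
        have h4 := mul_le_mul_of_nonneg_left h3 hi0.le
        have h5 : 0 ≤ m * e := by positivity
        have h6 : 0 < e * i := by positivity
        nlinarith
    obtain ⟨c, hc1, hc2⟩ := exists_between hlt
    refine ⟨c, ?_, ?_⟩
    -- By the semigroup property the increment after time `t` is that of the bounded function
    -- `expect P g t` run for a short time `v` from time `0`, where the rates apply.
    · filter_upwards [hP.expect_slope_lt hp hM (hP.expect_le hg0 hgM t)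
        (fun v => hP.summable_of_le hu0 (hP.expect_le hg0 hgM t) v i) hSu.hasSum hc1] with v hv
      rw [add_comm t v, ← (hP.hasSum_expect_add hg0 (hP.summable_of_le hg0 hgM) v t i).tsum_eq]
      exact hv.le
    · exact eventually_ge_of_hasDerivWithinAt hBD hc2

/-- For `s > 1` summability is not known beforehand. The bound on truncated powers is uniform in the
level, and a level above the finitely many `s ^ j` in a partial sum leaves these terms unchanged. -/
lemma summable_pow_of_transition (h : HasTwoFixedPoints p q r) (hr : 1 ≤ r) (hp : IsOffspringLaw p)
    (hP : IsTransitionFunction p P) (hs : s ∈ Set.Ico 0 r) (t : ℝ≥0) (i : ℕ) :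
    Summable (fun j => P t (some i) (some j) * s ^ j) ∧
      expect P (fun j => s ^ j) t i ≤ flow p q r t s ^ i := by
  have h0 : ∀ j, 0 ≤ P t (some i) (some j) * s ^ j := fun j =>
    mul_nonneg (hP.nonneg _ _ _) (pow_nonneg hs.1 j)
  have hA : ∀ A : Finset ℕ, ∑ j ∈ A, P t (some i) (some j) * s ^ j ≤ flow p q r t s ^ i := by
    intro A
    set M := ∑ j ∈ A, s ^ j with hM
    have hM0 : 0 ≤ M := Finset.sum_nonneg fun j _ => pow_nonneg hs.1 j
    refine le_trans ?_ (h.expect_min_le_flow_pow hr hp hP hs hM0 t i)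
    refine le_trans (Finset.sum_le_sum fun j hj => ?_)
      ((hP.summable_of_le (fun j => le_min (pow_nonneg hs.1 j) hM0)
        (fun j => min_le_right _ _) t i).sum_le_tsum A
        fun j _ => mul_nonneg (hP.nonneg _ _ _) (le_min (pow_nonneg hs.1 j) hM0))
    have hjM : s ^ j ≤ M := Finset.single_le_sum (fun k _ => pow_nonneg hs.1 k) hj
    simp only [min_eq_left hjM, le_refl]
  have hsum := summable_of_sum_le h0 hA
  exact ⟨hsum, hsum.tsum_le_of_sum_le hA⟩

/-- The bound at some `s'` with `s < s' < r` dominates the terms by `r ^ i * (s / s') ^ j`,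
uniformly in time. -/
lemma continuous_expect_pow (h : HasTwoFixedPoints p q r) (hr : 1 ≤ r) (hp : IsOffspringLaw p)
    (hP : IsTransitionFunction p P) (hs : s ∈ Set.Ico 0 r) (i : ℕ) :
    Continuous fun t => expect P (fun j => s ^ j) t i := by
  obtain ⟨s', hs1, hs2⟩ := exists_between hs.2
  have hs0 : 0 < s' := hs.1.trans_lt hs1
  have hs'I : s' ∈ Set.Ico 0 r := ⟨hs0.le, hs2⟩
  have hρ : Summable fun j : ℕ => r ^ i * (s / s') ^ j :=
    (summable_geometric_of_lt_one (div_nonneg hs.1 hs0.le) ((div_lt_one hs0).2 hs1)).mul_left _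
  refine continuous_tsum (fun j => (hP.continuous_apply i j).mul continuous_const) hρ fun j t => ?_
  obtain ⟨h1, h2⟩ := h.summable_pow_of_transition hr hp hP hs'I t i
  have h3 := h1.le_tsum j fun k _ => mul_nonneg (hP.nonneg _ _ _) (pow_nonneg hs0.le k)
  have hm := h.flow_mem t.2 hs'I
  have h4 : P t (some i) (some j) * s' ^ j ≤ r ^ i :=
    (h3.trans h2).trans (pow_le_pow_left₀ hm.1 hm.2.le i)
  rw [Real.norm_of_nonneg (mul_nonneg (hP.nonneg _ _ _) (pow_nonneg hs.1 j))]
  have h5 : P t (some i) (some j) * s ^ j = P t (some i) (some j) * s' ^ j * (s / s') ^ j := by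
    rw [div_pow]
    field_simp
  rw [h5]
  exact mul_le_mul_of_nonneg_right h4 (pow_nonneg (div_nonneg hs.1 hs0.le) j)

/-- Trajectories keep their strict order, so by compactness their ratio on `[0, τ]` has a maximum
below one. -/
lemma exists_flow_pow_le (h : HasTwoFixedPoints p q r) {s' : ℝ} (hs : s ∈ Set.Ico 0 r)
    (hs' : s' ∈ Set.Ico 0 r) (hlt : s < s') {ε : ℝ} (hε : 0 < ε) (τ : ℝ≥0) :
    ∃ N : ℕ, ∀ i, N ≤ i → ∀ t : ℝ≥0, t ≤ τ →
      flow p q r t s ^ i ≤ ε * flow p q r t s' ^ i := by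
  have hpos : ∀ t : ℝ≥0, 0 < flow p q r t s' := fun t =>
    (h.flow_mem t.2 hs).1.trans_lt (h.flow_lt_flow t.2 hs hs' hlt)
  have hcont : Continuous fun t : ℝ≥0 => flow p q r t s / flow p q r t s' := by
    have h1 := h.continuous_flow_pow hs 1
    have h2 := h.continuous_flow_pow hs' 1
    simp only [pow_one] at h1 h2
    exact h1.div h2 fun t => (hpos t).ne'
  obtain ⟨t₀, -, ht₀⟩ := isCompact_Icc.exists_isMaxOn (s := Set.Icc 0 τ)
    ⟨0, Set.left_mem_Icc.2 zero_le⟩ hcont.continuousOn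
  have h0 : ∀ t : ℝ≥0, 0 ≤ flow p q r t s / flow p q r t s' := fun t =>
    div_nonneg (h.flow_mem t.2 hs).1 (hpos t).le
  have h1 : flow p q r t₀ s / flow p q r t₀ s' < 1 :=
    (div_lt_one (hpos t₀)).2 (h.flow_lt_flow t₀.2 hs hs' hlt)
  obtain ⟨N, hN⟩ := exists_pow_lt_of_lt_one hε h1
  refine ⟨N, fun i hi t ht => ?_⟩
  rw [← div_le_iff₀ (pow_pos (hpos t) i), ← div_pow]
  calc (flow p q r t s / flow p q r t s') ^ i ≤ (flow p q r t₀ s / flow p q r t₀ s') ^ i :=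
        pow_le_pow_left₀ (h0 t) (ht₀ ⟨zero_le, ht⟩) i
    _ ≤ (flow p q r t₀ s / flow p q r t₀ s') ^ N := pow_le_pow_of_le_one (h0 t₀) h1.le hi
    _ ≤ ε := hN.le

/-- Powers of the flow may grow exponentially in `i`, so the barrier is `ε * exp t` times the power
of a larger trajectory started at `s' < r`. That power solves the backward equation, and the factor
`exp t` makes the slope strictly larger. -/
lemma flow_pow_le_expect (h : HasTwoFixedPoints p q r) (hr : 1 ≤ r) (hp : IsOffspringLaw p)
    (hP : IsTransitionFunction p P) (hs : s ∈ Set.Ico 0 r) (t : ℝ≥0) (i : ℕ) :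
    flow p q r t s ^ i ≤ expect P (fun j => s ^ j) t i := by
  set g : ℕ → ℝ := fun j => s ^ j with hg
  have hg0 : ∀ j, 0 ≤ g j := fun j => pow_nonneg hs.1 j
  have hgs : ∀ t i, Summable fun j => P t (some i) (some j) * g j := fun t i =>
    (h.summable_pow_of_transition hr hp hP hs t i).1
  have hgle : ∀ t i, expect P g t i ≤ flow p q r t s ^ i := fun t i =>
    (h.summable_pow_of_transition hr hp hP hs t i).2
  obtain ⟨s', hs1, hs2⟩ := exists_between hs.2
  have hs'I : s' ∈ Set.Ico 0 r := ⟨hs.1.trans hs1.le, hs2⟩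
  have hpos : ∀ t : ℝ≥0, 0 < flow p q r t s' := fun t =>
    (h.flow_mem t.2 hs).1.trans_lt (h.flow_lt_flow t.2 hs hs'I hs1)
  suffices hε : ∀ ε : ℝ, 0 < ε → flow p q r t s ^ i ≤
      ε * Real.exp t * flow p q r t s' ^ i + expect P g t i by
    refine le_of_forall_pos_le_add fun ε hε' => ?_
    have hpos' : 0 < Real.exp t * flow p q r t s' ^ i := mul_pos (Real.exp_pos _)
      (pow_pos (hpos t) i)
    have h1 := hε (ε / (Real.exp t * flow p q r t s' ^ i)) (div_pos hε' hpos')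
    rw [mul_assoc, div_mul_cancel₀ _ hpos'.ne'] at h1
    linarith
  intro ε hε
  refine le_of_touching (U := fun t i => flow p q r t s ^ i)
    (B := fun t i => ε * Real.exp t * flow p q r t s' ^ i + expect P g t i)
    (h.continuous_flow_pow hs) (fun i => ?_) (fun i => ?_) (fun τ => ?_)
    (fun t i heq hle => ?_) t i
  · exact ((by fun_prop : Continuous fun t : ℝ≥0 => ε * Real.exp t).mul
      (h.continuous_flow_pow hs'I i)).add (h.continuous_expect_pow hr hp hP hs i)
  · simp only [hP.expect_zero, NNReal.coe_zero, h.flow_zero hs, h.flow_zero hs'I]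
    have : 0 ≤ ε * Real.exp 0 * s' ^ i :=
      mul_nonneg (by positivity) (pow_nonneg hs'I.1 i)
    linarith
  · obtain ⟨N, hN⟩ := h.exists_flow_pow_le hs hs'I hs1 hε τ
    refine ⟨N, fun i hi t ht => (hN i hi t ht).trans ?_⟩
    have h1 : 1 ≤ Real.exp t := by rw [Real.one_le_exp_iff]; exact t.2
    have h2 : 0 ≤ ε * flow p q r t s' ^ i := mul_nonneg hε.le (pow_nonneg (hpos t).le i)
    have h3 := hP.expect_nonneg hg0 t i
    nlinarith
  · set e := ε * Real.exp t with he
    have he0 : 0 < e := by positivity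
    set φ := flow p q r t s with hφ
    set χ := flow p q r t s' with hχ
    have hχ0 : 0 < χ ^ i := pow_pos (hpos t) i
    have hVD : HasDerivWithinAt (fun u : ℝ => ε * Real.exp u * flow p q r u s' ^ i)
        (e * χ ^ i + e * (i * (χ ^ (i - 1) * genF p χ - χ ^ i))) (Set.Ici (t : ℝ)) t :=
      ((Real.hasDerivAt_exp t).const_mul ε).hasDerivWithinAt.mul
        (h.hasDerivWithinAt_flow_pow hs'I t i)
    have hu0 := hP.expect_nonneg hg0 t
    have hSφ := h.hasSum_flow_pow hs t i
    have hSχ := h.hasSum_flow_pow hs'I t i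
    have hSu : Summable fun k => p k * expect P g t (i - 1 + k) :=
      Summable.of_nonneg_of_le (fun k => mul_nonneg (h.nonneg k) (hu0 _))
        (fun k => mul_le_mul_of_nonneg_left (hgle t _) (h.nonneg k)) hSφ.summable
    have hSB : HasSum (fun k => p k * (e * χ ^ (i - 1 + k) + expect P g t (i - 1 + k)))
        (e * (χ ^ (i - 1) * genF p χ) + ∑' k, p k * expect P g t (i - 1 + k)) :=
      ((hSχ.mul_left e).add hSu.hasSum).congr_fun fun k => by ring
    have hle' := hasSum_le (fun k => mul_le_mul_of_nonneg_left (hle (i - 1 + k)) (h.nonneg k))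
      hSφ hSB
    have hlt : i * (φ ^ (i - 1) * genF p φ - φ ^ i) <
        (e * χ ^ i + e * (i * (χ ^ (i - 1) * genF p χ - χ ^ i))) +
          i * ((∑' k, p k * expect P g t (i - 1 + k)) - expect P g t i) := by
      rw [heq]
      have h1 := mul_le_mul_of_nonneg_left hle' (Nat.cast_nonneg (α := ℝ) i)
      have h2 : 0 < e * χ ^ i := mul_pos he0 hχ0
      nlinarith
    obtain ⟨c, hc1, hc2⟩ := exists_between hlt
    refine ⟨c, eventually_le_of_hasDerivWithinAt (h.hasDerivWithinAt_flow_pow hs t i) hc1, ?_⟩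
    -- The slope `c` is split into `δ` for the barrier and `c - δ` for the expectation.
    obtain ⟨δ, hδ1, hδ2⟩ := exists_between (sub_lt_iff_lt_add.2 hc2)
    have hsumu : ∀ v, Summable fun j => P v (some i) (some j) * expect P g t j := fun v =>
      (hP.hasSum_expect_add hg0 hgs v t i).summable
    filter_upwards [hP.lt_slope_expect hu0 hsumu hSu.hasSum
      (show c - δ < _ by linarith),
      eventually_ge_of_hasDerivWithinAt hVD hδ2] with v hv1 hv2
    rw [add_comm t v, ← (hP.hasSum_expect_add hg0 hgs v t i).tsum_eq]
    rw [add_comm t v] at hv2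
    simp only [expect] at hv1 hv2 ⊢
    linarith

/-- The generating function of the process started from one particle follows the flow. -/
lemma hasSum_flow (h : HasTwoFixedPoints p q r) (hr : 1 ≤ r) (hp : IsOffspringLaw p)
    (hP : IsTransitionFunction p P) (hs : s ∈ Set.Ico 0 r) (t : ℝ≥0) :
    HasSum (fun j => P t (some 1) (some j) * s ^ j) (flow p q r t s) := by
  obtain ⟨h1, h2⟩ := h.summable_pow_of_transition hr hp hP hs t 1
  have h3 := h.flow_pow_le_expect hr hp hP hs t 1
  rw [pow_one] at h2 h3
  have h4 : ∑' j, P t (some 1) (some j) * s ^ j = flow p q r t s := le_antisymm h2 h3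
  exact h4 ▸ h1.hasSum

end HasTwoFixedPoints

/-! ### Convergence of coefficients of power series -/

/-- Once the lower coefficients vanish, divide by `s ^ n` and let `s` decrease to `0`. -/
lemma eq_zero_of_hasSum_zero {c : ℕ → ℝ} {δ : ℝ} (hδ : 0 < δ)
    (h : ∀ s ∈ Set.Ioo 0 δ, HasSum (fun k => c k * s ^ k) 0) (n : ℕ) : c n = 0 := by
  induction n using Nat.strong_induction_on with
  | _ n ih =>
    have h1 : ∀ s ∈ Set.Ioo 0 δ, HasSum (fun k => c (k + n) * s ^ k) 0 := fun s hs => by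
      have h2 := (hasSum_nat_add_iff' n).2 (h s hs)
      rw [Finset.sum_eq_zero fun k hk => by rw [ih k (Finset.mem_range.1 hk), zero_mul],
        sub_zero] at h2
      have h3 := h2.div_const (s ^ n)
      rw [zero_div] at h3
      refine h3.congr_fun fun k => ?_
      have : s ^ n ≠ 0 := pow_ne_zero _ hs.1.ne'
      rw [pow_add]
      field_simp
    have hδ2 : δ / 2 ∈ Set.Ioo 0 δ := ⟨by positivity, by linarith⟩
    have hcont : ContinuousOn (fun s => ∑' k, c (k + n) * s ^ k) (Set.Icc 0 (δ / 2)) := by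
      refine continuousOn_tsum (fun k => by fun_prop) (h1 _ hδ2).summable.norm fun k s hs => ?_
      rw [norm_mul, norm_mul]
      refine mul_le_mul_of_nonneg_left ?_ (norm_nonneg _)
      rw [norm_pow, norm_pow, Real.norm_of_nonneg hs.1, Real.norm_of_nonneg hδ2.1.le]
      exact pow_le_pow_left₀ hs.1 hs.2 k
    have h4 : (∑' k, c (k + n) * (0 : ℝ) ^ k) = c n := by
      rw [tsum_eq_single 0 fun k hk => by simp [hk]]
      simp
    have h5 := (hcont 0 ⟨le_rfl, hδ2.1.le⟩).tendsto.mono_left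
      (nhdsWithin_mono 0 (Set.Ioc_subset_Icc_self (a := (0 : ℝ)) (b := δ / 2)))
    rw [h4] at h5
    have : (𝓝[Set.Ioc 0 (δ / 2)] (0 : ℝ)).NeBot := by
      rw [nhdsWithin_Ioc_eq_nhdsGT hδ2.1]
      infer_instance
    refine tendsto_nhds_unique h5 (tendsto_const_nhds.congr' ?_)
    filter_upwards [self_mem_nhdsWithin] with s hs
    exact (h1 s ⟨hs.1, hs.2.trans_lt hδ2.2⟩).tsum_eq.symm

lemma coeff_unique {c d : ℕ → ℝ} {H : ℝ → ℝ} {δ : ℝ} (hδ : 0 < δ)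
    (hc : ∀ s ∈ Set.Ioo 0 δ, HasSum (fun k => c k * s ^ k) (H s))
    (hd : ∀ s ∈ Set.Ioo 0 δ, HasSum (fun k => d k * s ^ k) (H s)) : c = d := by
  funext n
  refine sub_eq_zero.1 (eq_zero_of_hasSum_zero (c := fun k => c k - d k) hδ (fun s hs => ?_) n)
  have h1 := (hc s hs).sub (hd s hs)
  rw [sub_self] at h1
  exact h1.congr_fun fun k => by ring

/-- A continuity theorem: if generating functions with nonnegative coefficients converge on
`[0, r)`, then so do their coefficients, and the limit is the generating function of the limits. -/
theorem exists_tendsto_coeff {ι : Type*} {l : Filter ι} [l.NeBot] {a : ι → ℕ → ℝ} {H : ℝ → ℝ}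
    {r : ℝ} (hr : 0 < r) (ha : ∀ i k, 0 ≤ a i k)
    (hs : ∀ s ∈ Set.Ico 0 r, ∀ i, Summable fun k => a i k * s ^ k)
    (hlim : ∀ s ∈ Set.Ico 0 r, Tendsto (fun i => ∑' k, a i k * s ^ k) l (𝓝 (H s))) :
    ∃ π : ℕ → ℝ, (∀ k, Tendsto (fun i => a i k) l (𝓝 (π k))) ∧
      ∀ s ∈ Set.Ico 0 r, HasSum (fun k => π k * s ^ k) (H s) := by
  have hbound : ∀ s ∈ Set.Ico 0 r, ∀ᶠ i in l, ∀ k, a i k * s ^ k ≤ H s + 1 := fun s hsr => by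
    filter_upwards [(hlim s hsr).eventually (gt_mem_nhds (lt_add_one _))] with i hi k
    exact ((hs s hsr i).le_tsum k fun j _ => mul_nonneg (ha i j) (pow_nonneg hsr.1 j)).trans hi.le
  -- Along an ultrafilter bounded coefficients converge by compactness. Their limits have the
  -- generating function `H`, so they do not depend on the ultrafilter, and convergence along `l`
  -- follows.
  have hultra : ∀ U : Ultrafilter ι, (U : Filter ι) ≤ l → ∃ π : ℕ → ℝ,
      (∀ k, Tendsto (fun i => a i k) U (𝓝 (π k))) ∧
        ∀ s ∈ Set.Ico 0 r, HasSum (fun k => π k * s ^ k) (H s) := fun U hU => by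
    have hex : ∀ k, ∃ x, Tendsto (fun i => a i k) U (𝓝 x) := fun k => by
      have hr2 : r / 2 ∈ Set.Ico 0 r := ⟨by positivity, by linarith⟩
      have hpos : 0 < (r / 2) ^ k := by positivity
      have hmem : ∀ᶠ i in (U : Filter ι), a i k ∈ Set.Icc 0 ((H (r / 2) + 1) / (r / 2) ^ k) := by
        filter_upwards [hU (hbound _ hr2)] with i hi
        exact ⟨ha i k, (le_div_iff₀ hpos).2 (hi k)⟩
      obtain ⟨x, -, hx⟩ := isCompact_Icc.ultrafilter_le_nhds (U.map fun i => a i k)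
        (le_principal_iff.2 hmem)
      exact ⟨x, hx⟩
    choose π hπ using hex
    refine ⟨π, hπ, fun s hsr => ?_⟩
    -- The bound at the larger point `ρ` gives a geometric majorant at `s`.
    obtain ⟨ρ, hρ1, hρ2⟩ := exists_between hsr.2
    have hρ0 : 0 < ρ := hsr.1.trans_lt hρ1
    have hgeo : Summable fun k : ℕ => (H ρ + 1) * (s / ρ) ^ k :=
      (summable_geometric_of_lt_one (div_nonneg hsr.1 hρ0.le) ((div_lt_one hρ0).2 hρ1)).mul_left _
    have hpow : ∀ k, s ^ k = ρ ^ k * (s / ρ) ^ k := fun k => by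
      rw [div_pow]
      field_simp
    have hq : ∀ k, 0 ≤ (s / ρ) ^ k := fun k => pow_nonneg (div_nonneg hsr.1 hρ0.le) k
    have hb : ∀ᶠ i in (U : Filter ι), ∀ k, ‖a i k * s ^ k‖ ≤ (H ρ + 1) * (s / ρ) ^ k := by
      filter_upwards [hU (hbound ρ ⟨hρ0.le, hρ2⟩)] with i hi k
      rw [Real.norm_of_nonneg (mul_nonneg (ha i k) (pow_nonneg hsr.1 k)), hpow, ← mul_assoc]
      exact mul_le_mul_of_nonneg_right (hi k) (hq k)
    have hdom := tendsto_tsum_of_dominated_convergence hgeo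
      (fun k => (hπ k).mul_const (s ^ k)) hb
    have heq : ∑' k, π k * s ^ k = H s := tendsto_nhds_unique hdom ((hlim s hsr).mono_left hU)
    have hsum : Summable fun k => π k * s ^ k := by
      refine Summable.of_norm_bounded hgeo fun k => ?_
      refine le_of_tendsto ((hπ k).mul_const (s ^ k)).norm ?_
      filter_upwards [hb] with i hi using hi k
    exact heq ▸ hsum.hasSum
  obtain ⟨π, hπ1, hπ2⟩ := hultra (Ultrafilter.of l) (Ultrafilter.of_le l)
  refine ⟨π, fun k => ?_, hπ2⟩
  rw [tendsto_iff_ultrafilter]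
  intro U hU
  obtain ⟨π', hπ'1, hπ'2⟩ := hultra U hU
  rw [coeff_unique hr (fun s hs => hπ2 s ⟨hs.1.le, hs.2⟩) fun s hs => hπ'2 s ⟨hs.1.le, hs.2⟩]
  exact hπ'1 k

/-! ### The process and its absorption time -/

namespace IsBranchingProcess

variable {Ω : Type*} [MeasurableSpace Ω] {μ : Measure Ω} {p : ℕ → ℝ}
  {P : ℝ≥0 → Option ℕ → Option ℕ → ℝ} {Z : ℝ≥0 → Ω → Option ℕ}

/-- The finite-dimensional distributions of `Z` are given by `P`. -/
def HasTransition (μ : Measure Ω) (Z : ℝ≥0 → Ω → Option ℕ)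
    (P : ℝ≥0 → Option ℕ → Option ℕ → ℝ) : Prop :=
  ∀ (n : ℕ) (t : ℕ → ℝ≥0) (x : ℕ → Option ℕ), Monotone t → t 0 = 0 → x 0 = some 1 →
    μ.real {ω | ∀ i ≤ n, Z (t i) ω = x i} =
      ∏ i ∈ Finset.range n, P (t (i + 1) - t i) (x i) (x (i + 1))

lemma measureReal_two (hZ : IsBranchingProcess μ p Z) (hP : HasTransition μ Z P) {s t : ℝ≥0}
    (hst : s ≤ t) (x y : Option ℕ) :
    μ.real ({ω | Z s ω = x} ∩ {ω | Z t ω = y}) = P s (some 1) x * P (t - s) x y := by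
  have h1 := hP 2 (fun i => if i = 0 then 0 else if i = 1 then s else t)
    (fun i => if i = 0 then some 1 else if i = 1 then x else y)
    (monotone_nat_of_le_succ fun i => by
      rcases i with _ | _ | i
      · simp
      · simpa using hst
      · simp) rfl rfl
  simp only [Finset.prod_range_succ, Finset.prod_range_zero, one_mul, zero_add, one_ne_zero,
    if_true, if_false, tsub_zero, OfNat.ofNat_ne_one, Nat.reduceAdd, OfNat.ofNat_ne_zero] at h1
  rw [← h1]
  refine measureReal_congr ?_
  filter_upwards [hZ.initial] with ω hω
  refine propext ⟨fun h i hi => ?_, fun h => ⟨?_, ?_⟩⟩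
  · interval_cases i
    · exact hω
    · exact h.1
    · exact h.2
  · exact h 1 (by norm_num)
  · exact h 2 le_rfl

end IsBranchingProcess

namespace IsBranchingProcess

variable {Ω : Type*} [MeasurableSpace Ω] {μ : Measure Ω} {p : ℕ → ℝ}
  {P : ℝ≥0 → Option ℕ → Option ℕ → ℝ} {Z : ℝ≥0 → Ω → Option ℕ}

lemma measureReal_one (hZ : IsBranchingProcess μ p Z) (hPt : IsTransitionFunction p P)
    (hP : HasTransition μ Z P) (t : ℝ≥0) (x : Option ℕ) :
    μ.real {ω | Z t ω = x} = P t (some 1) x := by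
  have h1 := hZ.measureReal_two hP (zero_le (a := t)) (some 1) x
  rw [hPt.zero, if_pos rfl, one_mul, tsub_zero] at h1
  rw [← h1]
  refine measureReal_congr ?_
  filter_upwards [hZ.initial] with ω hω
  exact propext ⟨fun h => ⟨hω, h⟩, fun h => h.2⟩

variable [IsProbabilityMeasure μ]

lemma ae_absorbed_pair (hZ : IsBranchingProcess μ p Z) (hPt : IsTransitionFunction p P)
    (hP : HasTransition μ Z P) {x : Option ℕ} (hx : rate p x x = 0) {s t : ℝ≥0} (hst : s ≤ t) :
    ∀ᵐ ω ∂μ, Z s ω = x → Z t ω = x := by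
  have h1 := measureReal_inter_add_sdiff (μ := μ) (s := {ω | Z s ω = x}) (hZ.measurable t x)
  rw [hZ.measureReal_two hP hst, hPt.eq_one_of_rate_eq_zero hx, mul_one,
    hZ.measureReal_one hPt hP, add_eq_left, measureReal_eq_zero_iff] at h1
  rw [ae_iff]
  refine measure_mono_null (fun ω hω => ?_) h1
  simpa using hω

/-- The null sets for the pairs `(s, t)` are uncountably many. By right continuity a visit to `x`
before `t` lasts over an interval, which contains one of countably many dense times. -/
lemma ae_absorbed (hZ : IsBranchingProcess μ p Z) (hPt : IsTransitionFunction p P)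
    (hP : HasTransition μ Z P) {x : Option ℕ} (hx : rate p x x = 0) (t : ℝ≥0) :
    ∀ᵐ ω ∂μ, ∀ s ≤ t, Z s ω = x → Z t ω = x := by
  have h1 : ∀ᵐ ω ∂μ, ∀ n, TopologicalSpace.denseSeq ℝ≥0 n ≤ t →
      Z (TopologicalSpace.denseSeq ℝ≥0 n) ω = x → Z t ω = x := by
    rw [ae_all_iff]
    intro n
    by_cases hn : TopologicalSpace.denseSeq ℝ≥0 n ≤ t
    · filter_upwards [hZ.ae_absorbed_pair hPt hP hx hn] with ω hω _ using hω
    · exact Eventually.of_forall fun ω h => absurd h hn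
  filter_upwards [h1, hZ.right_continuous] with ω hω hrc s hs hsx
  rcases hs.eq_or_lt with rfl | hs
  · exact hsx
  obtain ⟨b, hb, hbI⟩ := (mem_nhdsGT_iff_exists_Ioo_subset' hs).1 (hrc s)
  obtain ⟨n, hn⟩ := (TopologicalSpace.denseRange_denseSeq ℝ≥0).exists_mem_open
    (isOpen_Ioo (a := s) (b := min b t)) (Set.nonempty_Ioo.2 (lt_min hb hs))
  refine hω n (hn.2.trans_le (min_le_right _ _)).le ?_
  exact (hbI ⟨hn.1, hn.2.trans_le (min_le_left _ _)⟩).trans hsx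

lemma ae_lt_hittingTime_iff (hZ : IsBranchingProcess μ p Z) (hPt : IsTransitionFunction p P)
    (hP : HasTransition μ Z P) {x : Option ℕ} (hx : rate p x x = 0) (t : ℝ≥0) :
    ∀ᵐ ω ∂μ, (t : ℝ≥0∞) < hittingTime Z x ω ↔ Z t ω ≠ x := by
  filter_upwards [hZ.ae_absorbed hPt hP hx t, hZ.right_continuous] with ω hω hrc
  constructor
  · intro h1 h2
    have h3 : hittingTime Z x ω ≤ t := sInf_le ⟨t, h2, rfl⟩
    exact absurd h3 (not_le.2 h1)
  · intro h1
    -- The path stays off `x` up to some `b > t`, which makes the inequality for the infimum strict.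
    obtain ⟨b, hb, hbI⟩ := (mem_nhdsGT_iff_exists_Ioo_subset' (lt_add_one t)).1 (hrc t)
    refine lt_of_lt_of_le (ENNReal.coe_lt_coe.2 hb) (le_sInf ?_)
    rintro - ⟨s, hs, rfl⟩
    refine ENNReal.coe_le_coe.2 (not_lt.1 fun hsb => ?_)
    rcases le_or_gt s t with hst | hst
    · exact h1 (hω s hst hs)
    · exact h1 ((hbI ⟨hst, hsb⟩ : Z s ω = Z t ω).symm.trans hs)

lemma ae_lt_absorptionTime_iff (hZ : IsBranchingProcess μ p Z) (hPt : IsTransitionFunction p P)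
    (hP : HasTransition μ Z P) (t : ℝ≥0) :
    ∀ᵐ ω ∂μ, (t : ℝ≥0∞) < absorptionTime Z ω ↔ Z t ω ≠ some 0 ∧ Z t ω ≠ none := by
  filter_upwards [hZ.ae_lt_hittingTime_iff hPt hP IsTransitionFunction.rate_some_zero t,
    hZ.ae_lt_hittingTime_iff hPt hP IsTransitionFunction.rate_none t] with ω h1 h2
  rw [absorptionTime, lt_min_iff, h1, h2]

/-- The survival probability in terms of the transition function. -/
lemma measureReal_survival (hZ : IsBranchingProcess μ p Z) (hPt : IsTransitionFunction p P)
    (hP : HasTransition μ Z P) (t : ℝ≥0) :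
    μ.real {ω | (t : ℝ≥0∞) < absorptionTime Z ω} =
      (∑' j, P t (some 1) (some j)) - P t (some 1) (some 0) := by
  have h1 : μ.real {ω | (t : ℝ≥0∞) < absorptionTime Z ω} =
      μ.real ({ω | Z t ω = some 0} ∪ {ω | Z t ω = none})ᶜ := by
    refine measureReal_congr ?_
    filter_upwards [hZ.ae_lt_absorptionTime_iff hPt hP t] with ω hω
    refine propext (hω.trans ?_)
    rw [← not_or]
    exact Iff.rfl
  have h2 : Disjoint {ω | Z t ω = some 0} {ω | Z t ω = none} :=
    Set.disjoint_left.2 fun ω h3 h4 => by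
      have h3' : Z t ω = some 0 := h3
      have h4' : Z t ω = none := h4
      simp [h3'] at h4'
  rw [h1, probReal_compl_eq_one_sub ((hZ.measurable t _).union (hZ.measurable t _)),
    measureReal_union h2 (hZ.measurable t _), hZ.measureReal_one hPt hP,
    hZ.measureReal_one hPt hP]
  have h3 := (hasSum_option (hPt.summable_some t (some 1)).hasSum).unique
    (hPt.hasSum_one t (some 1))
  linarith

/-- For `k ≥ 1` the event `Z t = k` lies almost surely inside survival. Only its measurability is
used, not that of the conditioning event. -/
lemma cond_survival (hZ : IsBranchingProcess μ p Z) (hPt : IsTransitionFunction p P)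
    (hP : HasTransition μ Z P) (t : ℝ≥0) {k : ℕ} (hk : 1 ≤ k) :
    (ProbabilityTheory.cond μ {ω | (t : ℝ≥0∞) < absorptionTime Z ω}).real {ω | Z t ω = some k} =
      P t (some 1) (some k) / ((∑' j, P t (some 1) (some j)) - P t (some 1) (some 0)) := by
  rw [← hZ.measureReal_survival hPt hP, ← hZ.measureReal_one hPt hP, measureReal_def,
    ProbabilityTheory.cond_apply' (hZ.measurable t _), ENNReal.toReal_mul, ENNReal.toReal_inv,
    ← measureReal_def, ← measureReal_def, inv_mul_eq_div]
  congr 1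
  refine measureReal_congr ?_
  filter_upwards [hZ.ae_lt_absorptionTime_iff hPt hP t] with ω hω
  refine propext ⟨fun h => h.2, fun h => ⟨hω.2 ?_, h⟩⟩
  have h' : Z t ω = some k := h
  rw [h']
  exact ⟨by simpa using Nat.one_le_iff_ne_zero.1 hk, by simp⟩

end IsBranchingProcess

namespace HasTwoFixedPoints

variable {p : ℕ → ℝ} {q r s : ℝ} {P : ℝ≥0 → Option ℕ → Option ℕ → ℝ}

lemma transition_zero (h : HasTwoFixedPoints p q r) (hr : 1 ≤ r) (hp : IsOffspringLaw p)
    (hP : IsTransitionFunction p P) (t : ℝ≥0) : P t (some 1) (some 0) = flow p q r t 0 := by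
  have h1 := (h.hasSum_flow hr hp hP ⟨le_rfl, h.r_pos⟩ t).tsum_eq
  rw [tsum_eq_single 0 fun k hk => by simp [hk]] at h1
  simpa using h1

lemma tsum_transition (h : HasTwoFixedPoints p q r) (hr : 1 < r) (hp : IsOffspringLaw p)
    (hP : IsTransitionFunction p P) (t : ℝ≥0) :
    ∑' j, P t (some 1) (some j) = flow p q r t 1 := by
  simpa using (h.hasSum_flow hr.le hp hP ⟨zero_le_one, hr⟩ t).tsum_eq

/-- The quotient equals `K s / E(φ_t(s))`, and `E` tends to `E(q) = 1` along the flow. -/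
lemma tendsto_flow_sub_div (h : HasTwoFixedPoints p q r) (hs : s ∈ Set.Ico 0 r) :
    Tendsto (fun t => (flow p q r t s - q) / Real.exp (-alphaOf p q * t)) atTop
      (𝓝 (kF p q r s)) := by
  have hE := (h.hasDerivAt_facE h.q_nonneg h.lt).continuousAt.tendsto.comp (h.tendsto_flow hs)
  have h1 := (tendsto_const_nhds (x := kF p q r s)).div hE (by rw [h.facE_q]; exact one_ne_zero)
  rw [h.facE_q, div_one] at h1
  refine h1.congr' ?_
  filter_upwards [eventually_ge_atTop 0] with t ht
  have h3 := h.kF_flow ht hs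
  have h4 := (h.facE_pos (h.flow_mem ht hs).2).ne'
  have h5 := (Real.exp_pos (-alphaOf p q * t)).ne'
  change kF p q r s / facE p q r (flow p q r t s) = _
  rw [div_eq_div_iff h4 h5, mul_comm, ← h3, kF]

lemma kF_one_sub_pos (h : HasTwoFixedPoints p q r) (hr : 1 < r) :
    0 < kF p q r 1 - kF p q r 0 :=
  sub_pos.2 (h.strictMonoOn_kF ⟨le_rfl, h.r_pos⟩ ⟨zero_le_one, hr⟩ one_pos)

lemma tendsto_ratio_flow (h : HasTwoFixedPoints p q r) (hr : 1 < r) (hs : s ∈ Set.Ico 0 r) :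
    Tendsto (fun t => (flow p q r t s - flow p q r t 0) / (flow p q r t 1 - flow p q r t 0)) atTop
      (𝓝 ((kF p q r s - kF p q r 0) / (kF p q r 1 - kF p q r 0))) := by
  have h0 := h.tendsto_flow_sub_div ⟨le_rfl, h.r_pos⟩
  have h1 := h.tendsto_flow_sub_div ⟨zero_le_one, hr⟩
  refine (((h.tendsto_flow_sub_div hs).sub h0).div (h1.sub h0)
    (h.kF_one_sub_pos hr).ne').congr fun t => ?_
  have h5 := (Real.exp_pos (-alphaOf p q * t)).ne'
  simp only [← sub_div, Pi.div_apply]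
  rw [div_div_div_cancel_right₀ h5]
  ring_nf

/-- The conditional limit law. -/
lemma exists_yaglom (h : HasTwoFixedPoints p q r) (hr : 1 < r) (hp : IsOffspringLaw p)
    (hP : IsTransitionFunction p P) : ∃ π : ℕ → ℝ,
      (∀ k, 1 ≤ k → Tendsto (fun t : ℝ≥0 => P t (some 1) (some k) /
        ((∑' j, P t (some 1) (some j)) - P t (some 1) (some 0))) atTop (𝓝 (π k))) ∧
      ∀ s ∈ Set.Ico 0 r, HasSum (fun k => π (k + 1) * s ^ (k + 1))
        ((kF p q r s - kF p q r 0) / (kF p q r 1 - kF p q r 0)) := by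
  have h0I : (0 : ℝ) ∈ Set.Ico 0 r := ⟨le_rfl, h.r_pos⟩
  set Δ : ℝ≥0 → ℝ := fun t => flow p q r t 1 - flow p q r t 0 with hΔ
  have hΔ0 : ∀ t, 0 ≤ Δ t := fun t =>
    (sub_pos.2 (h.flow_lt_flow t.2 h0I ⟨zero_le_one, hr⟩ one_pos)).le
  -- The conditional law given survival: the mass at `0` is removed and the rest is normalised by
  -- the survival probability.
  set a : ℝ≥0 → ℕ → ℝ := fun t k => (if k = 0 then 0 else P t (some 1) (some k)) / Δ t with ha
  have hsum : ∀ s ∈ Set.Ico 0 r, ∀ t : ℝ≥0,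
      HasSum (fun k => a t k * s ^ k) ((flow p q r t s - flow p q r t 0) / Δ t) := by
    intro s hs t
    have h1 : HasSum (fun k : ℕ => if k = 0 then flow p q r t 0 else 0) (flow p q r t 0) :=
      hasSum_ite_eq 0 _
    refine (((h.hasSum_flow hr.le hp hP hs t).sub h1).div_const (Δ t)).congr_fun fun k => ?_
    rcases eq_or_ne k 0 with rfl | hk
    · simp [ha, h.transition_zero hr.le hp hP]
    · simp [ha, hk]
      ring
  obtain ⟨π, hπ1, hπ2⟩ := exists_tendsto_coeff (a := a) h.r_pos
    (fun t k => div_nonneg (by split_ifs; exacts [le_rfl, hP.nonneg _ _ _]) (hΔ0 t))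
    (fun s hs t => (hsum s hs t).summable)
    (fun s hs => ((h.tendsto_ratio_flow hr hs).comp
      (NNReal.tendsto_coe_atTop.2 tendsto_id)).congr
      fun t => (hsum s hs t).tsum_eq.symm)
  have hπ0 : π 0 = 0 := by
    refine tendsto_nhds_unique (hπ1 0) ?_
    simp [ha]
  refine ⟨π, fun k hk => (hπ1 k).congr fun t => ?_, fun s hs => ?_⟩
  · rw [h.tsum_transition hr hp hP, h.transition_zero hr.le hp hP]
    simp [ha, hΔ, Nat.one_le_iff_ne_zero.1 hk]
  · have h1 := (hasSum_nat_add_iff' 1).2 (hπ2 s hs)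
    simpa [hπ0] using h1

/-- The asymptotic expansion of the survival probability. -/
lemma survival_isLittleO (h : HasTwoFixedPoints p q r) (hr : 1 < r) :
    (fun t : ℝ => flow p q r t 1 - flow p q r t 0 -
      ((kF p q r 1 - kF p q r 0) * Real.exp (-alphaOf p q * t) -
        genDeriv₂ p q / (2 * alphaOf p q) * (kF p q r 1 ^ 2 - kF p q r 0 ^ 2) *
          Real.exp (-2 * alphaOf p q * t)))
      =o[atTop] fun t => Real.exp (-2 * alphaOf p q * t) := by
  refine ((h.flow_sub_isLittleO ⟨zero_le_one, hr⟩).sub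
    (h.flow_sub_isLittleO ⟨le_rfl, h.r_pos⟩)).congr_left fun t => ?_
  ring

end HasTwoFixedPoints

/-! ### Modified linear-fractional laws -/

lemma tailSeq_of_geometric {c : ℕ → ℝ} {a b D : ℝ} {k : ℕ} (hab0 : 0 ≤ a * b) (hab : a * b < 1)
    (h : ∀ i, c (k + 1 + i) = D * a ^ i) : tailSeq b c k = D / (1 - a * b) := by
  have h1 := (hasSum_geometric_of_lt_one hab0 hab).mul_left D
  rw [tailSeq, div_eq_mul_inv, ← h1.tsum_eq]
  refine tsum_congr fun i => ?_
  rw [h, mul_pow]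
  ring

lemma IsModifiedLinearFractional.exists_coeff {p : ℕ → ℝ} (h : IsModifiedLinearFractional p) :
    ∃ c a : ℝ, 0 < c ∧ 0 ≤ a ∧ ∀ k, p (k + 2) = c * a ^ k := by
  obtain ⟨p₀, p₁, pΔ, a, -, -, -, -, -, -, hlt, ha0, ha1, hf⟩ := h
  refine ⟨(1 - p₀ - p₁ - pΔ) * (1 - a), a, mul_pos (by linarith) (by linarith), ha0, ?_⟩
  set d : ℕ → ℝ := fun k => match k with
    | 0 => p₀
    | 1 => p₁
    | k + 2 => (1 - p₀ - p₁ - pΔ) * (1 - a) * a ^ k with hd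
  have hpd : p = d := by
    refine coeff_unique one_pos (fun s hs => hf s hs.1.le ?_) fun s hs => ?_
    · nlinarith [hs.1, hs.2]
    · have has0 : 0 ≤ a * s := mul_nonneg ha0 hs.1.le
      have has1 : a * s < 1 := by nlinarith [hs.1, hs.2]
      refine (hasSum_nat_add_iff' 2).1 ?_
      have h1 := (hasSum_geometric_of_lt_one has0 has1).mul_left
        ((1 - p₀ - p₁ - pΔ) * (1 - a) * s ^ 2)
      have h2 : p₀ + p₁ * s + (1 - p₀ - p₁ - pΔ) * s ^ 2 * (1 - a) * (1 - a * s)⁻¹ -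
          ∑ i ∈ Finset.range 2, d i * s ^ i =
          (1 - p₀ - p₁ - pΔ) * (1 - a) * s ^ 2 * (1 - a * s)⁻¹ := by
        rw [Finset.sum_range_succ, Finset.sum_range_one]
        simp only [hd]
        ring
      rw [h2]
      refine h1.congr_fun fun k => ?_
      simp only [hd, mul_pow]
      ring
  intro k
  rw [hpd]

/-- The coefficients of the binomial series of `(1 - x) ^ (-γ)`. -/
noncomputable def negBinCoeff (γ : ℝ) (n : ℕ) : ℝ := Ring.choose (γ + n - 1) n

lemma hasSum_negBinCoeff (γ : ℝ) {x : ℝ} (hx : |x| < 1) :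
    HasSum (fun n => negBinCoeff γ n * x ^ n) ((1 - x) ^ (-γ)) := by
  have h1 := (Real.one_div_one_sub_rpow_hasFPowerSeriesOnBall_zero γ).hasSum
    (y := x) (by simpa [Metric.mem_eball, enorm_eq_nnnorm, ← NNReal.coe_lt_coe] using hx)
  have hx1 : 0 ≤ 1 - x := by linarith [le_abs_self x]
  rw [Real.rpow_neg hx1]
  simpa [FormalMultilinearSeries.ofScalars_apply_eq, negBinCoeff, mul_comm] using h1

lemma negBinCoeff_eq (γ : ℝ) (n : ℕ) :
    negBinCoeff γ n = (∏ j ∈ Finset.range n, (γ + j)) / n.factorial := by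
  have h1 := Ring.factorial_nsmul_multichoose_eq_ascPochhammer γ n
  have h2 : negBinCoeff γ n = Ring.multichoose γ n := by
    rw [negBinCoeff, Ring.choose]
    congr 1
    ring
  have h3 : ∀ n : ℕ, (ascPochhammer ℝ n).eval γ = ∏ j ∈ Finset.range n, (γ + j) := fun n => by
    induction n with
    | zero => simp
    | succ n ih => rw [ascPochhammer_succ_eval, ih, Finset.prod_range_succ]
  rw [Polynomial.ascPochhammer_smeval_eq_eval, h3, nsmul_eq_mul] at h1
  rw [h2, ← h1, mul_div_cancel_left₀ _ (Nat.cast_ne_zero.2 n.factorial_ne_zero)]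

lemma negBinCoeff_succ (γ : ℝ) (n : ℕ) :
    negBinCoeff γ (n + 1) = negBinCoeff γ n * ((γ + n) / (n + 1)) := by
  rw [negBinCoeff_eq, negBinCoeff_eq, Finset.prod_range_succ, Nat.factorial_succ]
  push_cast
  have : (n.factorial : ℝ) ≠ 0 := Nat.cast_ne_zero.2 n.factorial_ne_zero
  field_simp

/-- Euler's limit: `b n / n ^ (γ - 1)` is exactly `n / (n + γ)` divided by the `n`-th term of the
sequence converging to `Γ(γ)`. -/
lemma tendsto_negBinCoeff {γ : ℝ} (hγ : 0 < γ) :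
    Tendsto (fun n : ℕ => negBinCoeff γ n / ((n : ℝ) ^ (γ - 1)) * Real.Gamma γ) atTop (𝓝 1) := by
  have hG := (Real.Gamma_pos_of_pos hγ).ne'
  have h1 : Tendsto (fun n : ℕ => Real.Gamma γ / Real.GammaSeq γ n * ((n : ℝ) / (n + γ))) atTop
      (𝓝 (Real.Gamma γ / Real.Gamma γ * 1)) :=
    ((tendsto_const_nhds.div (Real.GammaSeq_tendsto_Gamma γ) hG)).mul (tendsto_natCast_div_add_atTop γ)
  rw [div_self hG, one_mul] at h1
  refine h1.congr' ?_
  filter_upwards [eventually_gt_atTop 0] with n hn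
  have hn0 : (0 : ℝ) < n := Nat.cast_pos.2 hn
  have hf : (n.factorial : ℝ) ≠ 0 := Nat.cast_ne_zero.2 n.factorial_ne_zero
  have hp : ∏ j ∈ Finset.range n, (γ + (j : ℝ)) ≠ 0 :=
    Finset.prod_ne_zero_iff.2 fun j _ => by positivity
  have hpow := (Real.rpow_pos_of_pos hn0 γ).ne'
  rw [negBinCoeff_eq, Real.GammaSeq, Finset.prod_range_succ, Real.rpow_sub_one hn0.ne']
  have : γ + n ≠ 0 := by positivity
  rw [add_comm (n : ℝ) γ]
  field_simp

namespace HasTwoFixedPoints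

variable {p : ℕ → ℝ} {q r s : ℝ}

/-- A divided difference at `b` keeps a geometric sequence geometric and contributes a factor `1 /
(1 - a * b)`. Both terms in the numerator of `ψ` are thus multiples of one geometric series, and `γ
= w(q)/w(r) = (1 - a r)/(1 - a q)` makes them equal. -/
lemma psi_eq_zero_of_geometric (h : HasTwoFixedPoints p q r) {c a : ℝ} (hc : 0 < c) (ha : 0 ≤ a)
    (hp : ∀ k, p (k + 2) = c * a ^ k) (hs : s ∈ Set.Ico 0 r) : psi p q r s = 0 := by
  have har0 : 0 ≤ a * r := mul_nonneg ha h.r_pos.le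
  -- Convergence of `f` at `r` forces the geometric tail to converge there.
  have har : a * r < 1 := by
    have h1 := summable_shift h.fixed_r.summable 2
    have h2 : Summable fun i => (a * r) ^ i := by
      refine (h1.mul_left c⁻¹).congr fun i => ?_
      rw [add_comm 2 i, hp, mul_pow]
      field_simp
    rw [summable_geometric_iff_norm_lt_one, Real.norm_of_nonneg har0] at h2
    exact h2
  have haq0 : 0 ≤ a * q := mul_nonneg ha h.q_nonneg
  have haq : a * q < 1 := (mul_le_mul_of_nonneg_left h.lt.le ha).trans_lt har
  have hr' : 1 - a * r ≠ 0 := (sub_pos.2 har).ne'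
  have hq' : 1 - a * q ≠ 0 := (sub_pos.2 haq).ne'
  have hu : ∀ k, tailSeq q p (k + 1) = c * a ^ k / (1 - a * q) := fun k =>
    tailSeq_of_geometric haq0 haq fun i => by
      rw [show k + 1 + 1 + i = k + i + 2 by ring, hp, pow_add]; ring
  have hw : ∀ k, wSeq p q r k = c / ((1 - a * q) * (1 - a * r)) * a ^ k := fun k => by
    have h1 : wSeq p q r k = c * a ^ k / (1 - a * q) / (1 - a * r) :=
      tailSeq_of_geometric har0 har fun i => by
        rw [show k + 1 + i = k + i + 1 by ring, hu, pow_add]; ring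
    rw [h1]
    field_simp
  set C := c / ((1 - a * q) * (1 - a * r)) with hC
  have hC0 : 0 < C := div_pos hc (mul_pos (sub_pos.2 haq) (sub_pos.2 har))
  have hwq : ∀ k, tailSeq q (wSeq p q r) k = C * a ^ (k + 1) / (1 - a * q) := fun k =>
    tailSeq_of_geometric haq0 haq fun i => by rw [hw, pow_add]; ring
  have hwr : ∀ k, tailSeq r (wSeq p q r) k = C * a ^ (k + 1) / (1 - a * r) := fun k =>
    tailSeq_of_geometric har0 har fun i => by rw [hw, pow_add]; ring
  have hWq : wF p q r q = C / (1 - a * q) := by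
    have h1 := (hasSum_geometric_of_lt_one haq0 haq).mul_left C
    rw [div_eq_mul_inv, ← h1.tsum_eq]
    exact tsum_congr fun k => by rw [hw, mul_pow]; ring
  have hWr : wF p q r r = C / (1 - a * r) := by
    have h1 := (hasSum_geometric_of_lt_one har0 har).mul_left C
    rw [div_eq_mul_inv, ← h1.tsum_eq]
    exact tsum_congr fun k => by rw [hw, mul_pow]; ring
  have hγ : gammaOf p q r / (1 - a * r) = 1 / (1 - a * q) := by
    have h1 := h.gamma_mul_wF_r
    rw [hWq, hWr] at h1
    field_simp at h1 ⊢
    linear_combination h1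
  have hdiff : genF (tailSeq q (wSeq p q r)) s -
      gammaOf p q r * ((wF p q r s - wF p q r r) / (s - r)) = 0 := by
    have h1 := ((h.summable_tailSeq_q_wSeq hs.1 hs.2.le).hasSum.sub
      ((h.hasSum_tailSeq_r_wSeq hs.1 hs.2).mul_left (gammaOf p q r)))
    refine h1.unique (hasSum_zero.congr_fun fun k => ?_)
    rw [hwq, hwr]
    linear_combination (-(C * a ^ (k + 1) * s ^ k)) * hγ
  rw [psi, h.tailGF_three hs.1 hs.2.le, h.tailGF_four_qrrx hs.1 hs.2,
    h.tailGF_four_qqrx hs.1 hs.2.le, hdiff, zero_div]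

lemma K_eq_of_geometric (h : HasTwoFixedPoints p q r) {c a : ℝ} (hc : 0 < c) (ha : 0 ≤ a)
    (hp : ∀ k, p (k + 2) = c * a ^ k) (hs : s ∈ Set.Ico 0 r) :
    K p q r s = (s - q) * (r - q) ^ gammaOf p q r * (r - s) ^ (-gammaOf p q r) := by
  have h1 : ∫ x in s..q, psi p q r x = ∫ x in s..q, (0 : ℝ) :=
    intervalIntegral.integral_congr fun x hx => h.psi_eq_zero_of_geometric hc ha hp
      ⟨(le_min hs.1 h.q_nonneg).trans hx.1, hx.2.trans_lt (max_lt hs.2 h.lt)⟩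
  rw [K, h1, intervalIntegral.integral_zero, Real.exp_zero, mul_one]

/-- If the limit law has the generating function `(K s - K 0) / D` with
`K s = (s - q) * (r - q) ^ γ * (r - s) ^ (-γ)`, its weights are regularly varying up to the
exponential factor `r ^ (-k)`. -/
lemma isEquivalent_of_hasSum {γ D : ℝ} (hγ : 0 < γ) (hD : 0 < D) (hr : 0 < r) (hqr : q < r)
    {F : ℝ → ℝ} (hF : ∀ s ∈ Set.Ico 0 r, F s = (s - q) * (r - q) ^ γ * (r - s) ^ (-γ))
    {π : ℕ → ℝ}
    (hπ : ∀ s ∈ Set.Ico 0 r, HasSum (fun k => π (k + 1) * s ^ (k + 1)) ((F s - F 0) / D)) :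
    ∃ c : ℝ, 0 < c ∧ Asymptotics.IsEquivalent atTop π
      (fun k : ℕ => c * (k : ℝ) ^ (γ - 1) * (r ^ k)⁻¹) := by
  set C := (r - q) ^ γ * r ^ (-γ) with hC
  have hrq : 0 < r - q := sub_pos.2 hqr
  have hC0 : 0 < C := mul_pos (Real.rpow_pos_of_pos hrq _) (Real.rpow_pos_of_pos hr _)
  set b := negBinCoeff γ with hb
  have hΓ : 0 < Real.Gamma γ := Real.Gamma_pos_of_pos hγ
  have hFsum : ∀ s ∈ Set.Ico 0 r, HasSum (fun n => C * (b n / r ^ n) * s ^ n)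
      ((r - q) ^ γ * (r - s) ^ (-γ)) := fun s hs => by
    have hsr : |s / r| < 1 := by
      rw [abs_of_nonneg (div_nonneg hs.1 hr.le), div_lt_one hr]
      exact hs.2
    have h1 := (hasSum_negBinCoeff γ hsr).mul_left C
    have h2 : (r - s) ^ (-γ) = r ^ (-γ) * (1 - s / r) ^ (-γ) := by
      rw [← Real.mul_rpow hr.le (by linarith [le_abs_self (s / r)])]
      congr 1
      field_simp
    rw [h2, ← mul_assoc]
    refine h1.congr_fun fun n => ?_
    rw [div_pow]
    ring
  -- Multiplying the binomial series `G` by `s - q` and removing the constant term gives the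
  -- coefficient `G_n - q * G_{n+1}` at `s ^ (n + 1)`.
  have hFsum' : ∀ s ∈ Set.Ico 0 r, HasSum
      (fun n => (C * (b n / r ^ n) - q * (C * (b (n + 1) / r ^ (n + 1)))) / D * s ^ (n + 1))
      ((F s - F 0) / D) := fun s hs => by
    have h1 := hFsum s hs
    have h2 := ((hasSum_nat_add_iff' 1).2 h1).mul_left q
    have h3 := ((h1.mul_left s).sub h2).div_const D
    have h4 := (hFsum 0 ⟨le_rfl, hr⟩).unique
      (hasSum_single 0 fun n hn => by rw [zero_pow hn, mul_zero])
    have h0I : (0 : ℝ) ∈ Set.Ico 0 r := ⟨le_rfl, hr⟩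
    have h5 : (F s - F 0) / D = (s * ((r - q) ^ γ * (r - s) ^ (-γ)) -
        q * ((r - q) ^ γ * (r - s) ^ (-γ) -
          ∑ i ∈ Finset.range 1, C * (b i / r ^ i) * s ^ i)) / D := by
      rw [hF s hs, hF 0 h0I, Finset.sum_range_one]
      congr 1
      simp only [pow_zero, mul_one] at h4 ⊢
      linear_combination q * h4
    rw [h5]
    refine h3.congr_fun fun n => ?_
    ring
  have hcoef : ∀ n, π (n + 1) =
      (C * (b n / r ^ n) - q * (C * (b (n + 1) / r ^ (n + 1)))) / D := fun n => by
    have hdiv : ∀ {c : ℕ → ℝ} {s S : ℝ}, s ∈ Set.Ioo 0 r →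
        HasSum (fun k => c k * s ^ (k + 1)) S → HasSum (fun k => c k * s ^ k) (S / s) :=
      fun {c s S} hs hS => (hS.div_const s).congr_fun fun k => by
        have := hs.1.ne'
        rw [pow_succ]
        field_simp
    exact congrFun (coeff_unique (c := fun n => π (n + 1)) hr
      (fun s hs => hdiv hs (hπ s ⟨hs.1.le, hs.2⟩))
      fun s hs => hdiv hs (hFsum' s ⟨hs.1.le, hs.2⟩)) n
  -- With `b (k - 1) ~ b k` the coefficient is asymptotic to `C * (r - q) * b k / (D * r ^ k)`, and
  -- `b k ~ k ^ (γ - 1) / Γ(γ)`. The exact relation `b (k - 1) = b k * k / (k + γ - 1)` gives the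
  -- second factor in `hlim`.
  refine ⟨C * (r - q) / (D * Real.Gamma γ), by positivity, ?_⟩
  have hlim : Tendsto (fun k : ℕ => (b k / ((k : ℝ) ^ (γ - 1)) * Real.Gamma γ) *
      ((r * ((k : ℝ) / (k + (γ - 1))) - q) / (r - q))) atTop (𝓝 1) := by
    have h1 := (tendsto_negBinCoeff hγ).mul
      ((((tendsto_natCast_div_add_atTop (γ - 1)).const_mul r).sub_const q).div_const (r - q))
    rwa [mul_one, one_mul, div_self hrq.ne'] at h1
  refine Asymptotics.isEquivalent_of_tendsto_one (hlim.congr' ?_)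
  filter_upwards [eventually_gt_atTop 0] with k hk
  obtain ⟨n, rfl⟩ := Nat.exists_eq_add_of_lt hk
  rw [zero_add] at hk ⊢
  have hn : (0 : ℝ) < ((n + 1 : ℕ) : ℝ) := Nat.cast_pos.2 hk
  have hpow := (Real.rpow_pos_of_pos hn (γ - 1)).ne'
  have hbn : b n = b (n + 1) * (((n + 1 : ℕ) : ℝ) / ((n + 1 : ℕ) + (γ - 1))) := by
    rw [hb, negBinCoeff_succ]
    push_cast
    have : (γ + n) ≠ 0 := by positivity
    rw [show (n : ℝ) + 1 + (γ - 1) = γ + n by ring]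
    field_simp
  simp only [Pi.div_apply]
  rw [hcoef, hbn]
  generalize (((n + 1 : ℕ) : ℝ) / ((n + 1 : ℕ) + (γ - 1))) = y
  have hD' := hD.ne'
  have hΓ' := hΓ.ne'
  have hC' := hC0.ne'
  have hrq' := hrq.ne'
  have hr' := hr.ne'
  rw [pow_succ]
  field_simp

end HasTwoFixedPoints

end ExtBranching

/-! ### Assembly of the main theorem. -/

theorem mainTheorem5 {Ω : Type*} [MeasurableSpace Ω] (μ : Measure Ω) [IsProbabilityMeasure μ]
    (p : ℕ → ℝ) (hp : ExtBranching.IsOffspringLaw p) (hp1 : p 1 ≠ 1)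
    (q r : ℝ) (hqr : ExtBranching.IsExtendable p q r) (hr : 1 < r)
    (hfr : Summable (fun k : ℕ => (k : ℝ) * p k * r ^ (k - 1)))
    (Z : ℝ≥0 → Ω → Option ℕ) (hZ : ExtBranching.IsBranchingProcess μ p Z) :
    let α := ExtBranching.alphaOf p q
    let γ := ExtBranching.gammaOf p q r
    let K := ExtBranching.K p q r
    let T := ExtBranching.absorptionTime Z
    ((fun t : ℝ≥0 => μ.real {ω | (t : ℝ≥0∞) < T ω} -
        ((K 1 - K 0) * Real.exp (-α * t) -
          ExtBranching.genDeriv₂ p q / (2 * α) * (K 1 ^ 2 - K 0 ^ 2) * Real.exp (-2 * α * t)))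
      =o[atTop] fun t : ℝ≥0 => Real.exp (-2 * α * t)) ∧
    ∃ π : ℕ → ℝ,
      (∀ k : ℕ, 1 ≤ k →
        Tendsto (fun t : ℝ≥0 =>
            (ProbabilityTheory.cond μ {ω | (t : ℝ≥0∞) < T ω}).real {ω | Z t ω = some k})
          atTop (𝓝 (π k))) ∧
      (∀ s ∈ Set.Ico 0 r,
        HasSum (fun k : ℕ => π (k + 1) * s ^ (k + 1)) ((K s - K 0) / (K 1 - K 0))) ∧
      (ExtBranching.IsModifiedLinearFractional p →
        (∀ s ∈ Set.Ico 0 r, K s = (s - q) * (r - q) ^ γ * (r - s) ^ (-γ)) ∧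
        ∃ c : ℝ, 0 < c ∧
          Asymptotics.IsEquivalent atTop π
            (fun k : ℕ => c * (k : ℝ) ^ (γ - 1) * (r ^ k)⁻¹)) := by
  intro α γ K T
  have h := ExtBranching.hasTwoFixedPoints hp hp1 hqr hfr
  obtain ⟨P, hPt, hP⟩ := hZ.markov
  have hK : ∀ s, 0 ≤ s → K s = ExtBranching.kF p q r s := fun s hs => h.K_eq_kF hs
  have hK1 := hK 1 zero_le_one
  have hK0 := hK 0 le_rfl
  refine ⟨?_, ?_⟩
  · rw [hK1, hK0]
    refine ((h.survival_isLittleO hr).comp_tendsto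
      (NNReal.tendsto_coe_atTop.2 tendsto_id)).congr_left fun t => ?_
    rw [hZ.measureReal_survival hPt hP, h.tsum_transition hr hp hPt,
      h.transition_zero hr.le hp hPt]
    rfl
  · obtain ⟨π, hπ1, hπ2⟩ := h.exists_yaglom hr hp hPt
    have hπK : ∀ s ∈ Set.Ico 0 r,
        HasSum (fun k : ℕ => π (k + 1) * s ^ (k + 1)) ((K s - K 0) / (K 1 - K 0)) := fun s hs => by
      rw [hK1, hK0, hK s hs.1]
      exact hπ2 s hs
    refine ⟨π, fun k hk => ?_, hπK, fun hM => ?_⟩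
    · exact (hπ1 k hk).congr fun t => (hZ.cond_survival hPt hP t hk).symm
    · obtain ⟨c, a, hc, ha, hpa⟩ := hM.exists_coeff
      have hKs : ∀ s ∈ Set.Ico 0 r, K s = (s - q) * (r - q) ^ γ * (r - s) ^ (-γ) := fun s hs =>
        h.K_eq_of_geometric hc ha hpa hs
      have hD : 0 < K 1 - K 0 := by
        rw [hK1, hK0]
        exact h.kF_one_sub_pos hr
      exact ⟨hKs, ExtBranching.HasTwoFixedPoints.isEquivalent_of_hasSum h.gamma_pos hD h.r_pos
        h.lt hKs hπK⟩
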